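/- Let $\Omega$ be a set, $\mathcal A$ an algebra of subsets of $\Omega$ and $\lambda$ a bounded, finitely additive real set function on $\mathcal A$ with $\lambda\neq 0$; let $|\lambda|$ denote its total variation. Write $L^1(\lambda)$ for the space of $\lambda$-integrable real functions in the sense of Dunford and Schwartz (functions $f$ that are limits in $\lambda$-measure of a sequence of $\mathcal A$-simple functions that is Cauchy for the seminorm $g\mapsto\int|g|\,d|\lambda|$), with seminorm $f\mapsto\int|f|\,d|\lambda|$, write $\mu(f)=\int f\,d\mu$, and let $\mathrm{Sim}(\mathcal A)_+$ be the set of nonnegative $\mathcal A$-simple functions. Let $\mathcal K\subset L^1(\lambda)$ be convex with $0\in\mathcal K$, let $\mathcal C=\mathcal K-\mathrm{Sim}(\mathcal A)_+$, and let $\overline{\mathcal C}$ be the closure of $\mathcal C$ in $L^1(\lambda)$. Then the following are equivalent: (i) for each $f\in L^1(\lambda)$ with $f\ge 0$ and $|\lambda|(f)>0$ there exists $\eta>0$ such that $\eta f\notin\overline{\mathcal C}$; (ii) for each $A\in\mathcal A$ with $|\lambda|(A)>0$ there exists $d>0$ such that $d\,\mathbf 1_A\notin\overline{\mathcal C}$;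 (iii) there exists a finitely additive probability $m$ on $\mathcal A$ such that (a) $\mathcal K\subset L^1(m)$ and $\sup_{k\in\mathcal K}m(k)<\infty$; (b) there is $c>0$ with $m\le c|\lambda|$ on $\mathcal A$; and (c) for all $A\in\mathcal A$, $m(A)=0$ if and only if $|\lambda|(A)=0$. -/

import Mathlib

open Set Filter Topology MeasureTheory
open scoped Pointwise

namespace FinAdd

noncomputable section

variable {Ω : Type*}

/-- A real set function `μ` is bounded on the family `𝒜`. For an algebra of sets `𝒜`, the elements
of `ba(𝒜)` are the `μ : AddContent ℝ 𝒜` with this property. (Values of set functions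
outside `𝒜` are irrelevant everywhere below.) -/
def IsBoundedOn (𝒜 : Set (Set Ω)) (μ : Set Ω → ℝ) : Prop :=
  ∃ B : ℝ, ∀ A ∈ 𝒜, |μ A| ≤ B

/-- The total variation `|μ|`: `|μ|(A)` is the supremum of `∑ |μ(E)|` over finite families of
pairwise disjoint sets `E ∈ 𝒜` with `E ⊆ A`. -/
def totalVar (𝒜 : Set (Set Ω)) (μ : Set Ω → ℝ) (A : Set Ω) : ℝ :=
  sSup {r : ℝ | ∃ P : Finset (Set Ω), (∀ E ∈ P, E ∈ 𝒜 ∧ E ⊆ A) ∧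
    (P : Set (Set Ω)).PairwiseDisjoint id ∧ r = ∑ E ∈ P, |μ E|}

/-- The outer set function `|μ|*(S) = inf {|μ|(A) : A ∈ 𝒜, S ⊆ A}`, for arbitrary `S ⊆ Ω`. -/
def outerVar (𝒜 : Set (Set Ω)) (μ : Set Ω → ℝ) (S : Set Ω) : ℝ :=
  sInf {r : ℝ | ∃ A ∈ 𝒜, S ⊆ A ∧ r = totalVar 𝒜 μ A}

/-- `Sim(𝒜)`: the real functions with finitely many values, each taken on a set of `𝒜`. -/
def Sim (𝒜 : Set (Set Ω)) : Set (Ω → ℝ) :=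
  {f | (range f).Finite ∧ ∀ x : ℝ, f ⁻¹' {x} ∈ 𝒜}

/-- `Sim(𝒜)₊`: the nonnegative simple functions. -/
def SimPos (𝒜 : Set (Set Ω)) : Set (Ω → ℝ) :=
  {f | f ∈ Sim 𝒜 ∧ ∀ ω, 0 ≤ f ω}

/-- The integral of a simple function, `∑ x · μ(f = x)` over the finitely many values of `f`. -/
def simIntegral (μ : Set Ω → ℝ) (f : Ω → ℝ) : ℝ :=
  ∑ᶠ x ∈ range f, x * μ (f ⁻¹' {x})

/-- A sequence of simple functions determines `f` if it converges to `f` in `μ`-measure and is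
Cauchy in mean with respect to `|μ|`. -/
structure IsDetermining (𝒜 : Set (Set Ω)) (μ : Set Ω → ℝ) (s : ℕ → Ω → ℝ) (f : Ω → ℝ) :
    Prop where
  simple : ∀ n, s n ∈ Sim 𝒜
  tendsto_measure : ∀ ε : ℝ, 0 < ε →
    Tendsto (fun n => outerVar 𝒜 μ {ω | ε < |s n ω - f ω|}) atTop (𝓝 0)
  cauchy : Tendsto
    (fun p : ℕ × ℕ => simIntegral (totalVar 𝒜 μ) (fun ω => |s p.1 ω - s p.2 ω|)) atTop (𝓝 0)

/-- `L¹(μ)` in the sense of Dunford and Schwartz, as a set of functions (not of classes of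
functions modulo null functions): `f` is `μ`-integrable if it has a determining sequence. -/
def L1 (𝒜 : Set (Set Ω)) (μ : Set Ω → ℝ) : Set (Ω → ℝ) :=
  {f | ∃ s : ℕ → Ω → ℝ, IsDetermining 𝒜 μ s f}

/-- `I` is the integral of `f` with respect to `μ`: the limit of the integrals of a determining
sequence of simple functions. -/
def HasIntegral (𝒜 : Set (Set Ω)) (μ : Set Ω → ℝ) (f : Ω → ℝ) (I : ℝ) : Prop :=
  ∃ s : ℕ → Ω → ℝ, IsDetermining 𝒜 μ s f ∧
    Tendsto (fun n => simIntegral μ (s n)) atTop (𝓝 I)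

open scoped Classical in
/-- The Dunford-Schwartz integral `μ(f) = ∫ f dμ` of `f ∈ L¹(μ)` (zero if `f` is not
integrable). -/
def integral (𝒜 : Set (Set Ω)) (μ : Set Ω → ℝ) (f : Ω → ℝ) : ℝ :=
  if h : ∃ I, HasIntegral 𝒜 μ f I then h.choose else 0

/-- The closure of a set `C` of functions in `L¹(μ)`, for the seminorm `∫ |f| d|μ|`. -/
def L1closure (𝒜 : Set (Set Ω)) (μ : Set Ω → ℝ) (C : Set (Ω → ℝ)) : Set (Ω → ℝ) :=
  {f | f ∈ L1 𝒜 μ ∧ ∀ ε : ℝ, 0 < ε →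
    ∃ g ∈ C, g ∈ L1 𝒜 μ ∧ integral 𝒜 (totalVar 𝒜 μ) (fun ω => |f ω - g ω|) < ε}

/-- A finitely additive set function on `𝒜` is a finitely additive probability if it is
nonnegative with total mass one. -/
structure IsProb (𝒜 : Set (Set Ω)) (m : AddContent ℝ 𝒜) : Prop where
  nonneg : ∀ A ∈ 𝒜, 0 ≤ m A
  total : m univ = 1

end

end FinAdd

/-! Write ν = |λ|. (i) ⇒ (ii) takes f = 1_A. For (iii) ⇒ (i), domination m ≤ cν makes m continuous
for the L¹(ν) seminorm, so an upper bound S of m on K persists on the closure of K - Sim₊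
(`integral_le_of_mem_closure`). A function f ≥ 0 with ν(f) > 0 exceeds some δ > 0 on a set of
positive ν-content (`exists_le_of_integral_pos`), hence m(f) > 0, and large multiples of f leave the
closure.

The substance is (ii) ⇒ (iii). Hahn–Banach separates d·1_A from K - Sim₊ by a continuous functional
φ. Since the convex set contains 0 and the cone -Sim₊, φ is nonnegative on Sim₊, bounded above on K,
and φ(1_A) > 0 (`exists_functional_charging`). Density of simple functions identifies φ with the
integral against the content A ↦ φ(1_A) (`integral_contentOf`).

It remains to find one functional charging all A with ν(A) > 0, as in the Yan and Halmos–Savage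
theorems. Such functionals are stable under sums and suitably weighted countable sums
(`exists_hasSum_smul`). Without countable additivity there is no union of supports to maximise;
instead one maximises the mass of the lattice infimum of the content and ν
(`exists_charging_content`). Normalising the result gives m. -/

namespace FinAdd

noncomputable section

variable {Ω : Type*}

variable {𝒜 : Set (Set Ω)}

/-! ### Total variation and nonnegative contents -/

section TotalVariation

variable {μ : AddContent ℝ 𝒜}

/-- Split P by the sign of μ: each half sums, up to sign, to the value of μ on a union that is again
in 𝒜. -/
theorem sum_abs_le_of_isBoundedOn (h𝒜 : IsSetAlgebra 𝒜) {B : ℝ} (hB : ∀ A ∈ 𝒜, |μ A| ≤ B)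
    {P : Finset (Set Ω)} (hP : ∀ E ∈ P, E ∈ 𝒜) (hd : (P : Set (Set Ω)).PairwiseDisjoint id) :
    ∑ E ∈ P, |μ E| ≤ 2 * B := by
  classical
  rw [← Finset.sum_filter_add_sum_filter_not P (fun E => 0 ≤ μ E)]
  have key : ∀ Q ⊆ P, |∑ E ∈ Q, μ E| ≤ B := fun Q hQ => by
    have h := addContent_biUnion_eq (m := μ) h𝒜.isSetRing (s := id) (S := Q)
      (fun E hE => hP E (hQ hE)) (hd.subset (Finset.coe_subset.2 hQ))
    simp only [id] at h
    rw [← h]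
    exact hB _ (h𝒜.biUnion_mem Q fun E hE => hP E (hQ hE))
  have h1 : ∑ E ∈ P with 0 ≤ μ E, |μ E| ≤ B := by
    rw [Finset.sum_congr rfl fun E hE => abs_of_nonneg (Finset.mem_filter.1 hE).2]
    exact (le_abs_self _).trans (key _ (Finset.filter_subset _ _))
  have h2 : ∑ E ∈ P with ¬ 0 ≤ μ E, |μ E| ≤ B := by
    rw [Finset.sum_congr rfl fun E hE => abs_of_neg (not_le.1 (Finset.mem_filter.1 hE).2),
      Finset.sum_neg_distrib]
    exact (neg_le_abs _).trans (key _ (Finset.filter_subset _ _))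
  linarith

theorem bddAbove_totalVar (h𝒜 : IsSetAlgebra 𝒜) (hμ : IsBoundedOn 𝒜 μ) (A : Set Ω) :
    BddAbove {r : ℝ | ∃ P : Finset (Set Ω), (∀ E ∈ P, E ∈ 𝒜 ∧ E ⊆ A) ∧
      (P : Set (Set Ω)).PairwiseDisjoint id ∧ r = ∑ E ∈ P, |μ E|} := by
  obtain ⟨B, hB⟩ := hμ
  refine ⟨2 * B, ?_⟩
  rintro r ⟨P, hP, hd, rfl⟩
  exact sum_abs_le_of_isBoundedOn h𝒜 hB (fun E hE => (hP E hE).1) hd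

theorem sum_abs_le_totalVar (h𝒜 : IsSetAlgebra 𝒜) (hμ : IsBoundedOn 𝒜 μ) {A : Set Ω}
    {P : Finset (Set Ω)} (hP : ∀ E ∈ P, E ∈ 𝒜 ∧ E ⊆ A)
    (hd : (P : Set (Set Ω)).PairwiseDisjoint id) :
    ∑ E ∈ P, |μ E| ≤ totalVar 𝒜 μ A :=
  le_csSup (bddAbove_totalVar h𝒜 hμ A) ⟨P, hP, hd, rfl⟩

theorem totalVar_le {A : Set Ω} {r : ℝ}
    (h : ∀ P : Finset (Set Ω), (∀ E ∈ P, E ∈ 𝒜 ∧ E ⊆ A) →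
      (P : Set (Set Ω)).PairwiseDisjoint id → ∑ E ∈ P, |μ E| ≤ r) :
    totalVar 𝒜 μ A ≤ r := by
  refine csSup_le ⟨0, ∅, by simp, by simp, by simp⟩ ?_
  rintro _ ⟨P, hP, hd, rfl⟩
  exact h P hP hd

theorem abs_le_totalVar (h𝒜 : IsSetAlgebra 𝒜) (hμ : IsBoundedOn 𝒜 μ) {A : Set Ω} (hA : A ∈ 𝒜) :
    |μ A| ≤ totalVar 𝒜 μ A := by
  have := sum_abs_le_totalVar h𝒜 hμ (A := A) (P := {A}) (by simp [hA]) (by simp)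
  simpa using this

theorem totalVar_empty (h𝒜 : IsSetAlgebra 𝒜) (hμ : IsBoundedOn 𝒜 μ) :
    totalVar 𝒜 μ ∅ = 0 := by
  refine le_antisymm (totalVar_le fun P hP _ => ?_) ?_
  · refine (Finset.sum_eq_zero fun E hE => ?_).le
    rw [subset_empty_iff.1 (hP E hE).2, addContent_empty, abs_zero]
  · exact (abs_nonneg _).trans (abs_le_totalVar h𝒜 hμ h𝒜.empty_mem)

theorem sum_abs_inter_le_totalVar (h𝒜 : IsSetAlgebra 𝒜) (hμ : IsBoundedOn 𝒜 μ) {A : Set Ω}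
    (hA : A ∈ 𝒜) {P : Finset (Set Ω)} (hP : ∀ E ∈ P, E ∈ 𝒜)
    (hd : (P : Set (Set Ω)).PairwiseDisjoint id) :
    ∑ E ∈ P, |μ (E ∩ A)| ≤ totalVar 𝒜 μ A := by
  classical
  have hd' : (P : Set (Set Ω)).PairwiseDisjoint (· ∩ A) :=
    hd.mono fun E => inter_subset_left
  -- E ↦ E ∩ A need not be injective on P, but disjoint sets can share only the trace ∅, where μ
  -- vanishes.
  rw [← Finset.sum_image_of_disjoint (g := fun E => |μ E|) (by simp) hd']
  refine sum_abs_le_totalVar h𝒜 hμ ?_ ?_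
  · simp only [Finset.mem_image]
    rintro _ ⟨E, hE, rfl⟩
    exact ⟨h𝒜.inter_mem (hP E hE) hA, inter_subset_right⟩
  · rw [Finset.coe_image]
    exact hd'.image

theorem totalVar_union (h𝒜 : IsSetAlgebra 𝒜) (hμ : IsBoundedOn 𝒜 μ) {A B : Set Ω}
    (hA : A ∈ 𝒜) (hB : B ∈ 𝒜) (hAB : Disjoint A B) :
    totalVar 𝒜 μ (A ∪ B) = totalVar 𝒜 μ A + totalVar 𝒜 μ B := by
  classical
  refine le_antisymm (totalVar_le fun P hP hd => ?_) ?_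
  · refine le_trans ?_ (add_le_add
      (sum_abs_inter_le_totalVar h𝒜 hμ hA (fun E hE => (hP E hE).1) hd)
      (sum_abs_inter_le_totalVar h𝒜 hμ hB (fun E hE => (hP E hE).1) hd))
    rw [← Finset.sum_add_distrib]
    refine Finset.sum_le_sum fun E hE => ?_
    have hE' : E = E ∩ A ∪ E ∩ B := by
      rw [← inter_union_distrib_left, inter_eq_left.2 (hP E hE).2]
    conv_lhs => rw [hE', addContent_union h𝒜.isSetRing (h𝒜.inter_mem (hP E hE).1 hA)
      (h𝒜.inter_mem (hP E hE).1 hB) (hAB.mono inter_subset_right inter_subset_right)]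
    exact abs_add_le _ _
  · rw [← le_sub_iff_add_le]
    refine totalVar_le fun P hP hPd => ?_
    rw [le_sub_comm]
    refine totalVar_le fun Q hQ hQd => ?_
    rw [le_sub_iff_add_le]
    -- A set common to both families lies in A ∩ B, so it is empty and counting it twice is
    -- harmless.
    have h0 : ∑ E ∈ Q ∩ P, |μ E| = 0 := by
      refine Finset.sum_eq_zero fun E hE => ?_
      rw [Finset.mem_inter] at hE
      rw [subset_empty_iff.1 (hAB.le_bot.trans' (le_inf (hP E hE.2).2 (hQ E hE.1).2)),
        addContent_empty, abs_zero]
    rw [← Finset.sum_union_inter, h0, add_zero]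
    refine sum_abs_le_totalVar h𝒜 hμ ?_ ?_
    · intro E hE
      rcases Finset.mem_union.1 hE with h | h
      · exact ⟨(hQ E h).1, (hQ E h).2.trans subset_union_right⟩
      · exact ⟨(hP E h).1, (hP E h).2.trans subset_union_left⟩
    · rw [Finset.coe_union, pairwiseDisjoint_union]
      exact ⟨hQd, hPd, fun E hE F hF _ => (hAB.mono (hP F hF).2 (hQ E hE).2).symm⟩

/-- The total variation of a bounded finitely additive set function, as an additive content. -/
def variation (h𝒜 : IsSetAlgebra 𝒜) (μ : AddContent ℝ 𝒜) (hμ : IsBoundedOn 𝒜 μ) :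
    AddContent ℝ 𝒜 :=
  h𝒜.isSetRing.addContent_of_union (totalVar 𝒜 μ) (totalVar_empty h𝒜 hμ)
    fun hA hB hAB => totalVar_union h𝒜 hμ hA hB hAB

@[simp]
theorem coe_variation (h𝒜 : IsSetAlgebra 𝒜) (hμ : IsBoundedOn 𝒜 μ) :
    ⇑(variation h𝒜 μ hμ) = totalVar 𝒜 μ := rfl

theorem variation_nonneg (h𝒜 : IsSetAlgebra 𝒜) (hμ : IsBoundedOn 𝒜 μ) :
    ∀ A ∈ 𝒜, 0 ≤ variation h𝒜 μ hμ A :=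
  fun _ hA => (abs_nonneg _).trans (abs_le_totalVar h𝒜 hμ hA)

theorem content_mono (h𝒜 : IsSetAlgebra 𝒜) (hμ : ∀ A ∈ 𝒜, 0 ≤ μ A) {A B : Set Ω}
    (hA : A ∈ 𝒜) (hB : B ∈ 𝒜) (h : A ⊆ B) : μ A ≤ μ B := by
  have := addContent_union (m := μ) h𝒜.isSetRing hA (h𝒜.sdiff_mem hB hA) disjoint_sdiff_right
  rw [union_sdiff_cancel h] at this
  linarith [hμ _ (h𝒜.sdiff_mem hB hA)]

theorem content_union_le (h𝒜 : IsSetAlgebra 𝒜) (hμ : ∀ A ∈ 𝒜, 0 ≤ μ A) {A B : Set Ω}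
    (hA : A ∈ 𝒜) (hB : B ∈ 𝒜) : μ (A ∪ B) ≤ μ A + μ B := by
  have := addContent_union (m := μ) h𝒜.isSetRing hA (h𝒜.sdiff_mem hB hA) disjoint_sdiff_right
  rw [union_sdiff_self] at this
  linarith [content_mono h𝒜 hμ (h𝒜.sdiff_mem hB hA) hB sdiff_subset]

theorem isBoundedOn_of_nonneg (h𝒜 : IsSetAlgebra 𝒜) (hμ : ∀ A ∈ 𝒜, 0 ≤ μ A) :
    IsBoundedOn 𝒜 μ :=
  ⟨μ univ, fun A hA => by
    rw [abs_of_nonneg (hμ A hA)]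
    exact content_mono h𝒜 hμ hA h𝒜.univ_mem (subset_univ _)⟩

theorem totalVar_of_nonneg (h𝒜 : IsSetAlgebra 𝒜) (hμ : ∀ A ∈ 𝒜, 0 ≤ μ A) {A : Set Ω}
    (hA : A ∈ 𝒜) : totalVar 𝒜 μ A = μ A := by
  refine le_antisymm (totalVar_le fun P hP hd => ?_)
    ((le_abs_self _).trans (abs_le_totalVar h𝒜 (isBoundedOn_of_nonneg h𝒜 hμ) hA))
  rw [Finset.sum_congr rfl fun E hE => abs_of_nonneg (hμ E (hP E hE).1)]
  have h := addContent_biUnion_eq (m := μ) h𝒜.isSetRing (s := id) (S := P)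
    (fun E hE => (hP E hE).1) hd
  simp only [id] at h
  rw [← h]
  exact content_mono h𝒜 hμ (h𝒜.biUnion_mem P fun E hE => (hP E hE).1) hA
    (iUnion₂_subset fun E hE => (hP E hE).2)

end TotalVariation

/-! ### Integration of simple functions -/

section Simple

variable {μ : AddContent ℝ 𝒜} {f g : Ω → ℝ}

theorem preimage_comp_mem (h𝒜 : IsSetAlgebra 𝒜) {ι : Type*} {h : Ω → ι} (hfin : (range h).Finite)
    (hmem : ∀ i, h ⁻¹' {i} ∈ 𝒜) (S : Set ι) : h ⁻¹' S ∈ 𝒜 := by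
  classical
  have : h ⁻¹' S = ⋃ i ∈ hfin.toFinset.filter (· ∈ S), h ⁻¹' {i} := by
    ext ω
    simp
  rw [this]
  exact h𝒜.biUnion_mem _ fun i _ => hmem i

theorem finite_range_pair (hf : f ∈ Sim 𝒜) (hg : g ∈ Sim 𝒜) :
    (range fun ω => (f ω, g ω)).Finite :=
  (hf.1.prod hg.1).subset (range_subset_iff.2 fun ω => ⟨mem_range_self ω, mem_range_self ω⟩)

theorem preimage_pair_mem (h𝒜 : IsSetAlgebra 𝒜) (hf : f ∈ Sim 𝒜) (hg : g ∈ Sim 𝒜) (p : ℝ × ℝ) :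
    (fun ω => (f ω, g ω)) ⁻¹' {p} ∈ 𝒜 := by
  have : (fun ω => (f ω, g ω)) ⁻¹' {p} = f ⁻¹' {p.1} ∩ g ⁻¹' {p.2} := by
    ext ω
    simp [Prod.ext_iff]
  rw [this]
  exact h𝒜.inter_mem (hf.2 _) (hg.2 _)

theorem setOf_mem_of_sim (h𝒜 : IsSetAlgebra 𝒜) (hf : f ∈ Sim 𝒜) (p : ℝ → Prop) :
    {ω | p (f ω)} ∈ 𝒜 :=
  preimage_comp_mem h𝒜 hf.1 hf.2 {x | p x}

theorem sim_comp₂ (h𝒜 : IsSetAlgebra 𝒜) (F : ℝ → ℝ → ℝ) (hf : f ∈ Sim 𝒜) (hg : g ∈ Sim 𝒜) :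
    (fun ω => F (f ω) (g ω)) ∈ Sim 𝒜 := by
  refine ⟨((finite_range_pair hf hg).image fun p => F p.1 p.2).subset ?_, fun x => ?_⟩
  · rintro _ ⟨ω, rfl⟩
    exact ⟨_, mem_range_self ω, rfl⟩
  · exact preimage_comp_mem h𝒜 (finite_range_pair hf hg) (preimage_pair_mem h𝒜 hf hg)
      {p | F p.1 p.2 = x}

theorem sim_comp (h𝒜 : IsSetAlgebra 𝒜) (F : ℝ → ℝ) (hf : f ∈ Sim 𝒜) :
    (fun ω => F (f ω)) ∈ Sim 𝒜 :=
  sim_comp₂ h𝒜 (fun x _ => F x) hf hf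

theorem indicator_const_mem_sim (h𝒜 : IsSetAlgebra 𝒜) {A : Set Ω} (hA : A ∈ 𝒜) (c : ℝ) :
    A.indicator (fun _ => c) ∈ Sim 𝒜 := by
  classical
  refine ⟨(toFinite {c, 0}).subset ?_, fun x => ?_⟩
  · rintro _ ⟨ω, rfl⟩
    by_cases h : ω ∈ A <;> simp [h]
  · rw [indicator_const_preimage_eq_union]
    refine h𝒜.union_mem ?_ ?_ <;> split_ifs
    · exact hA
    · exact h𝒜.empty_mem
    · exact h𝒜.compl_mem hA
    · exact h𝒜.empty_mem

theorem const_mem_sim (h𝒜 : IsSetAlgebra 𝒜) (c : ℝ) : (fun _ : Ω => c) ∈ Sim 𝒜 := by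
  simpa using indicator_const_mem_sim h𝒜 h𝒜.univ_mem c

/-- Additivity lets the integral be computed on any finite partition finer than the level sets. With
h = (f, g), the functions f, g and f + g share one partition, and linearity becomes an identity of
finite sums. -/
theorem simIntegral_comp (h𝒜 : IsSetAlgebra 𝒜) (μ : AddContent ℝ 𝒜) {ι : Type*} {h : Ω → ι}
    (hfin : (range h).Finite) (hmem : ∀ i, h ⁻¹' {i} ∈ 𝒜) (F : ι → ℝ) :
    simIntegral μ (fun ω => F (h ω)) = ∑ i ∈ hfin.toFinset, F i * μ (h ⁻¹' {i}) := by
  classical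
  have hr : range (fun ω => F (h ω)) = ↑(hfin.toFinset.image F) := by
    ext x
    simp
  rw [simIntegral, hr, finsum_mem_coe_finset,
    ← Finset.sum_fiberwise_of_maps_to (g := F) (fun i hi => Finset.mem_image_of_mem F hi)]
  refine Finset.sum_congr rfl fun x _ => ?_
  have hpre : (fun ω => F (h ω)) ⁻¹' {x} =
      ⋃ i ∈ hfin.toFinset.filter (F · = x), h ⁻¹' {i} := by
    ext ω
    simp
  rw [hpre, addContent_biUnion_eq h𝒜.isSetRing (fun i _ => hmem i), Finset.mul_sum]
  · exact Finset.sum_congr rfl fun i hi => by rw [(Finset.mem_filter.1 hi).2]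
  · intro i _ j _ hij
    exact (disjoint_singleton.2 hij).preimage h

theorem simIntegral_comp₂ (h𝒜 : IsSetAlgebra 𝒜) (μ : AddContent ℝ 𝒜) (F : ℝ → ℝ → ℝ)
    (hf : f ∈ Sim 𝒜) (hg : g ∈ Sim 𝒜) :
    simIntegral μ (fun ω => F (f ω) (g ω)) = ∑ p ∈ (finite_range_pair hf hg).toFinset,
      F p.1 p.2 * μ ((fun ω => (f ω, g ω)) ⁻¹' {p}) :=
  simIntegral_comp h𝒜 μ (finite_range_pair hf hg) (preimage_pair_mem h𝒜 hf hg)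
    fun p => F p.1 p.2

theorem simIntegral_add (h𝒜 : IsSetAlgebra 𝒜) (hf : f ∈ Sim 𝒜) (hg : g ∈ Sim 𝒜) :
    simIntegral μ (fun ω => f ω + g ω) = simIntegral μ f + simIntegral μ g := by
  have h1 := simIntegral_comp₂ h𝒜 μ (fun x _ => x) hf hg
  have h2 := simIntegral_comp₂ h𝒜 μ (fun _ y => y) hf hg
  have h3 := simIntegral_comp₂ h𝒜 μ (fun x y => x + y) hf hg
  rw [h3, show simIntegral μ f = _ from h1, show simIntegral μ g = _ from h2,
    ← Finset.sum_add_distrib]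
  exact Finset.sum_congr rfl fun p _ => add_mul _ _ _

theorem simIntegral_const_mul (h𝒜 : IsSetAlgebra 𝒜) (c : ℝ) (hf : f ∈ Sim 𝒜) :
    simIntegral μ (fun ω => c * f ω) = c * simIntegral μ f := by
  have h1 := simIntegral_comp₂ h𝒜 μ (fun x _ => x) hf hf
  have h2 := simIntegral_comp₂ h𝒜 μ (fun x _ => c * x) hf hf
  rw [h2, show simIntegral μ f = _ from h1, Finset.mul_sum]
  exact Finset.sum_congr rfl fun p _ => mul_assoc _ _ _

theorem simIntegral_sub (h𝒜 : IsSetAlgebra 𝒜) (hf : f ∈ Sim 𝒜) (hg : g ∈ Sim 𝒜) :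
    simIntegral μ (fun ω => f ω - g ω) = simIntegral μ f - simIntegral μ g := by
  have h1 := simIntegral_add (μ := μ) h𝒜 (sim_comp₂ h𝒜 (· - ·) hf hg) hg
  simp only [sub_add_cancel] at h1
  linarith

theorem simIntegral_nonneg (hμ : ∀ A ∈ 𝒜, 0 ≤ μ A) (hf : f ∈ Sim 𝒜) (h : ∀ ω, 0 ≤ f ω) :
    0 ≤ simIntegral μ f := by
  refine finsum_mem_induction (0 ≤ ·) le_rfl (fun _ _ => add_nonneg) ?_
  rintro _ ⟨ω, rfl⟩
  exact mul_nonneg (h ω) (hμ _ (hf.2 _))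

theorem simIntegral_mono (h𝒜 : IsSetAlgebra 𝒜) (hμ : ∀ A ∈ 𝒜, 0 ≤ μ A) (hf : f ∈ Sim 𝒜)
    (hg : g ∈ Sim 𝒜) (h : ∀ ω, f ω ≤ g ω) : simIntegral μ f ≤ simIntegral μ g := by
  rw [← sub_nonneg, ← simIntegral_sub h𝒜 hg hf]
  exact simIntegral_nonneg hμ (sim_comp₂ h𝒜 (· - ·) hg hf) fun ω => sub_nonneg.2 (h ω)

theorem abs_simIntegral_le (h𝒜 : IsSetAlgebra 𝒜) (hμ : ∀ A ∈ 𝒜, 0 ≤ μ A) (hf : f ∈ Sim 𝒜) :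
    |simIntegral μ f| ≤ simIntegral μ (fun ω => |f ω|) := by
  have ha := sim_comp h𝒜 (|·|) hf
  rw [abs_le']
  refine ⟨simIntegral_mono h𝒜 hμ hf ha fun ω => le_abs_self _, ?_⟩
  have h1 := simIntegral_const_mul (μ := μ) h𝒜 (-1) hf
  have h2 := simIntegral_mono h𝒜 hμ (sim_comp h𝒜 (-1 * ·) hf) ha
    fun ω => by simpa using neg_le_abs (f ω)
  linarith

theorem simIntegral_indicator_const (h𝒜 : IsSetAlgebra 𝒜) {A : Set Ω} (hA : A ∈ 𝒜) (c : ℝ) :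
    simIntegral μ (A.indicator fun _ => c) = c * μ A := by
  classical
  have hfin : (range fun ω => ω ∈ A).Finite := toFinite _
  have hmem : ∀ i : Prop, (fun ω => ω ∈ A) ⁻¹' {i} ∈ 𝒜 := fun i => by
    by_cases hi : i
    · convert hA using 1
      ext ω
      simp [hi]
    · convert h𝒜.compl_mem hA using 1
      ext ω
      simp [hi]
  have h := simIntegral_comp h𝒜 μ hfin hmem fun p => if p then c else 0
  have h' : (A.indicator fun _ => c) = fun ω => if ω ∈ A then c else 0 := by
    ext ω
    simp [indicator_apply]
  -- If A is ∅ or Ω, one truth value may not be attained; its fibre is empty and contributes 0.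
  rw [h', h, Finset.sum_subset (Finset.subset_univ _), Fintype.sum_Prop]
  · simp
  · intro p _ hp
    have : (fun ω => ω ∈ A) ⁻¹' {p} = ∅ := by
      rw [Finite.mem_toFinset] at hp
      exact preimage_singleton_eq_empty.2 hp
    rw [this, addContent_empty, mul_zero]

theorem simIntegral_zero : simIntegral μ (fun _ => 0) = 0 := by
  refine finsum_mem_eq_zero_of_forall_eq_zero ?_
  rintro _ ⟨ω, rfl⟩
  exact zero_mul _

theorem simIntegral_congr {μ ν : Set Ω → ℝ} (h : ∀ A ∈ 𝒜, μ A = ν A) (hf : f ∈ Sim 𝒜) :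
    simIntegral μ f = simIntegral ν f :=
  finsum_mem_congr rfl fun x _ => by rw [h _ (hf.2 x)]

theorem simIntegral_le_mul {ν : AddContent ℝ 𝒜} {c : ℝ} (h : ∀ A ∈ 𝒜, μ A ≤ c * ν A)
    (hf : f ∈ Sim 𝒜) (hf0 : ∀ ω, 0 ≤ f ω) : simIntegral μ f ≤ c * simIntegral ν f := by
  rw [simIntegral, simIntegral, finsum_mem_eq_finite_toFinset_sum _ hf.1,
    finsum_mem_eq_finite_toFinset_sum _ hf.1, Finset.mul_sum]
  refine Finset.sum_le_sum fun x hx => ?_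
  obtain ⟨ω, rfl⟩ := hf.1.mem_toFinset.1 hx
  rw [mul_left_comm]
  exact mul_le_mul_of_nonneg_left (h _ (hf.2 _)) (hf0 ω)

theorem exists_abs_le_of_sim (hf : f ∈ Sim 𝒜) : ∃ M : ℝ, 0 ≤ M ∧ ∀ ω, |f ω| ≤ M := by
  obtain ⟨M, hM⟩ := (hf.1.image (|·|)).bddAbove
  exact ⟨max M 0, le_max_right _ _, fun ω =>
    (hM ⟨_, mem_range_self ω, rfl⟩).trans (le_max_left _ _)⟩

theorem sim_eq_sum_indicator (hf : f ∈ Sim 𝒜) :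
    f = ∑ x ∈ hf.1.toFinset, x • (f ⁻¹' {x}).indicator (1 : Ω → ℝ) := by
  ext ω
  rw [Finset.sum_apply, Finset.sum_eq_single (f ω)]
  · simp
  · intro x _ hx
    simp [hx.symm]
  · intro h
    exact absurd (hf.1.mem_toFinset.2 (mem_range_self ω)) h

end Simple

/-! ### The Dunford–Schwartz integral for a nonnegative content -/

section Integral

variable {ν : AddContent ℝ 𝒜} {f g : Ω → ℝ} {s t : ℕ → Ω → ℝ}

/-- A reformulation of `IsDetermining` for a nonnegative additive content, without outer
set functions. -/
structure Determines (ν : AddContent ℝ 𝒜) (s : ℕ → Ω → ℝ) (f : Ω → ℝ) : Prop where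
  simple : ∀ n, s n ∈ Sim 𝒜
  measure : ∀ ε > 0, ∀ η > 0, ∃ N, ∀ n ≥ N, ∃ A ∈ 𝒜, (∀ ω ∉ A, |s n ω - f ω| ≤ ε) ∧ ν A < η
  cauchy : ∀ ε > 0, ∃ N, ∀ n ≥ N, ∀ k ≥ N, simIntegral ν (fun ω => |s n ω - s k ω|) < ε

theorem outerVar_nonneg {μ : Set Ω → ℝ} (h : ∀ A ∈ 𝒜, 0 ≤ totalVar 𝒜 μ A) (S : Set Ω) :
    0 ≤ outerVar 𝒜 μ S :=
  Real.sInf_nonneg fun _ ⟨A, hA, _, hr⟩ => hr ▸ h A hA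

theorem outerVar_lt_iff (h𝒜 : IsSetAlgebra 𝒜) {μ : Set Ω → ℝ}
    (h : ∀ A ∈ 𝒜, 0 ≤ totalVar 𝒜 μ A) {S : Set Ω} {η : ℝ} :
    outerVar 𝒜 μ S < η ↔ ∃ A ∈ 𝒜, S ⊆ A ∧ totalVar 𝒜 μ A < η := by
  have hb : BddBelow {r : ℝ | ∃ A ∈ 𝒜, S ⊆ A ∧ r = totalVar 𝒜 μ A} :=
    ⟨0, fun _ ⟨A, hA, _, hr⟩ => hr ▸ h A hA⟩
  rw [outerVar, csInf_lt_iff hb ⟨_, univ, h𝒜.univ_mem, subset_univ _, rfl⟩]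
  constructor
  · rintro ⟨_, ⟨A, hA, hS, rfl⟩, hlt⟩
    exact ⟨A, hA, hS, hlt⟩
  · rintro ⟨A, hA, hS, hlt⟩
    exact ⟨_, ⟨A, hA, hS, rfl⟩, hlt⟩

/-- Only the variation of μ enters the definition. Keeping μ apart from ν covers both λ with ν = |λ|
and a nonnegative content, which is its own variation. -/
theorem isDetermining_iff (h𝒜 : IsSetAlgebra 𝒜) (hν : ∀ A ∈ 𝒜, 0 ≤ ν A) {μ : Set Ω → ℝ}
    (h : ∀ A ∈ 𝒜, totalVar 𝒜 μ A = ν A) : IsDetermining 𝒜 μ s f ↔ Determines ν s f := by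
  have h0 : ∀ A ∈ 𝒜, 0 ≤ totalVar 𝒜 μ A := fun A hA => (h A hA).symm ▸ hν A hA
  have hm : (∀ ε : ℝ, 0 < ε →
      Tendsto (fun n => outerVar 𝒜 μ {ω | ε < |s n ω - f ω|}) atTop (𝓝 0)) ↔
      ∀ ε > 0, ∀ η > 0, ∃ N, ∀ n ≥ N, ∃ A ∈ 𝒜, (∀ ω ∉ A, |s n ω - f ω| ≤ ε) ∧ ν A < η := by
    refine forall₂_congr fun ε _ => ?_
    rw [Metric.tendsto_atTop]
    refine forall₂_congr fun η _ => exists_congr fun N => forall₂_congr fun n _ => ?_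
    rw [Real.dist_0_eq_abs, abs_of_nonneg (outerVar_nonneg h0 _), outerVar_lt_iff h𝒜 h0]
    refine exists_congr fun A => and_congr_right fun hA => ?_
    rw [h A hA]
    refine and_congr_left fun _ => forall_congr' fun ω => ?_
    rw [mem_ofPred_eq, ← not_le, not_imp_comm]
  constructor
  · rintro ⟨h1, h2, h3⟩
    refine ⟨h1, hm.1 h2, fun ε hε => ?_⟩
    rw [← prod_atTop_atTop_eq, (atTop_basis.prod_self.tendsto_iff Metric.nhds_basis_ball)] at h3
    obtain ⟨N, -, hN⟩ := h3 ε hε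
    refine ⟨N, fun n hn k hk => ?_⟩
    have := hN (n, k) ⟨hn, hk⟩
    rw [Metric.mem_ball, Real.dist_0_eq_abs] at this
    rw [← simIntegral_congr h (sim_comp₂ h𝒜 (fun x y => |x - y|) (h1 n) (h1 k))]
    exact (le_abs_self _).trans_lt this
  · rintro ⟨h1, h2, h3⟩
    refine ⟨h1, hm.2 h2, ?_⟩
    rw [← prod_atTop_atTop_eq, (atTop_basis.prod_self.tendsto_iff Metric.nhds_basis_ball)]
    intro ε hε
    obtain ⟨N, hN⟩ := h3 ε hε
    refine ⟨N, trivial, fun p hp => ?_⟩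
    have hs := sim_comp₂ h𝒜 (fun x y => |x - y|) (h1 p.1) (h1 p.2)
    rw [Metric.mem_ball, Real.dist_0_eq_abs, simIntegral_congr h hs,
      abs_of_nonneg (simIntegral_nonneg hν hs fun _ => abs_nonneg _)]
    exact hN _ hp.1 _ hp.2

theorem isDetermining_iff_of_nonneg (h𝒜 : IsSetAlgebra 𝒜) (hν : ∀ A ∈ 𝒜, 0 ≤ ν A) :
    IsDetermining 𝒜 ν s f ↔ Determines ν s f :=
  isDetermining_iff h𝒜 hν fun _ hA => totalVar_of_nonneg h𝒜 hν hA

/-- This makes the integral well defined. Fix s N by the Cauchy property and a bound M for |s N|;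
then |s n| ≤ δ + |s n - s N| + M·1_A, where A, chosen after M, is a small set off which |s n| ≤ δ.
Each term contributes at most ε/3. -/
theorem Determines.tendsto_zero (h𝒜 : IsSetAlgebra 𝒜) (hν : ∀ A ∈ 𝒜, 0 ≤ ν A)
    (h : Determines ν s (fun _ => 0)) :
    Tendsto (fun n => simIntegral ν fun ω => |s n ω|) atTop (𝓝 0) := by
  rw [Metric.tendsto_atTop]
  intro ε hε
  have hu := hν univ h𝒜.univ_mem
  obtain ⟨N, hN⟩ := h.cauchy (ε / 3) (by positivity)
  obtain ⟨M, hM0, hM⟩ := exists_abs_le_of_sim (h.simple N)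
  obtain ⟨N', hN'⟩ := h.measure (ε / (3 * (ν univ + 1))) (by positivity)
    (ε / (3 * (M + 1))) (by positivity)
  refine ⟨max N N', fun n hn => ?_⟩
  obtain ⟨A, hA, hsA, hνA⟩ := hN' n (le_of_max_le_right hn)
  have hsn := sim_comp h𝒜 (|·|) (h.simple n)
  rw [Real.dist_0_eq_abs, abs_of_nonneg (simIntegral_nonneg hν hsn fun _ => abs_nonneg _)]
  set δ := ε / (3 * (ν univ + 1)) with hδ
  have hδ0 : 0 ≤ δ := by positivity
  have hi1 := indicator_const_mem_sim h𝒜 h𝒜.univ_mem δ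
  have hi2 := sim_comp₂ h𝒜 (fun x y => |x - y|) (h.simple n) (h.simple N)
  have hi3 := indicator_const_mem_sim h𝒜 hA M
  have hle : simIntegral ν (fun ω => |s n ω|) ≤ simIntegral ν (fun ω =>
      ((univ : Set Ω).indicator (fun _ => δ) ω + |s n ω - s N ω|) + A.indicator (fun _ => M) ω) := by
    refine simIntegral_mono h𝒜 hν hsn (sim_comp₂ h𝒜 (· + ·) (sim_comp₂ h𝒜 (· + ·) hi1 hi2) hi3) ?_
    intro ω
    simp only [indicator_univ]
    by_cases hω : ω ∈ A
    · rw [indicator_of_mem hω]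
      have := abs_add_le (s n ω - s N ω) (s N ω)
      rw [sub_add_cancel] at this
      linarith [hM ω]
    · rw [indicator_of_notMem hω]
      have := hsA ω hω
      rw [sub_zero] at this
      linarith [abs_nonneg (s n ω - s N ω)]
  rw [simIntegral_add h𝒜 (sim_comp₂ h𝒜 (· + ·) hi1 hi2) hi3, simIntegral_add h𝒜 hi1 hi2,
    simIntegral_indicator_const h𝒜 h𝒜.univ_mem, simIntegral_indicator_const h𝒜 hA] at hle
  have e1 : δ * ν univ ≤ ε / 3 := by
    rw [hδ, div_mul_eq_mul_div, div_le_div_iff₀ (by positivity) (by positivity)]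
    nlinarith
  have e2 : M * ν A ≤ ε / 3 := by
    refine (mul_le_mul_of_nonneg_left hνA.le hM0).trans ?_
    rw [mul_div_assoc', div_le_div_iff₀ (by positivity) (by positivity)]
    nlinarith
  linarith [hN n (le_of_max_le_left hn) N le_rfl]

/-- The Lipschitz bound transfers both convergence in measure and the Cauchy property; sums,
differences, absolute values and multiples are instances. -/
theorem Determines.comp₂ (h𝒜 : IsSetAlgebra 𝒜) (hν : ∀ A ∈ 𝒜, 0 ≤ ν A) (hf : Determines ν s f)
    (hg : Determines ν t g) (F : ℝ → ℝ → ℝ) {c : ℝ} (hc : 0 < c)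
    (hF : ∀ x y x' y', |F x y - F x' y'| ≤ c * (|x - x'| + |y - y'|)) :
    Determines ν (fun n ω => F (s n ω) (t n ω)) (fun ω => F (f ω) (g ω)) where
  simple n := sim_comp₂ h𝒜 F (hf.simple n) (hg.simple n)
  measure ε hε η hη := by
    obtain ⟨N₁, h₁⟩ := hf.measure (ε / (2 * c)) (by positivity) (η / 2) (by positivity)
    obtain ⟨N₂, h₂⟩ := hg.measure (ε / (2 * c)) (by positivity) (η / 2) (by positivity)
    refine ⟨max N₁ N₂, fun n hn => ?_⟩
    obtain ⟨A, hA, hsA, hνA⟩ := h₁ n (le_of_max_le_left hn)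
    obtain ⟨B, hB, hsB, hνB⟩ := h₂ n (le_of_max_le_right hn)
    refine ⟨A ∪ B, h𝒜.union_mem hA hB, fun ω hω => ?_, ?_⟩
    · rw [mem_union, not_or] at hω
      refine (hF _ _ _ _).trans ?_
      calc c * (|s n ω - f ω| + |t n ω - g ω|) ≤ c * (ε / (2 * c) + ε / (2 * c)) :=
            mul_le_mul_of_nonneg_left (add_le_add (hsA ω hω.1) (hsB ω hω.2)) hc.le
        _ = ε := by field_simp; ring
    · linarith [content_union_le h𝒜 hν hA hB]
  cauchy ε hε := by
    obtain ⟨N₁, h₁⟩ := hf.cauchy (ε / (2 * c)) (by positivity)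
    obtain ⟨N₂, h₂⟩ := hg.cauchy (ε / (2 * c)) (by positivity)
    refine ⟨max N₁ N₂, fun n hn k hk => ?_⟩
    have i1 := sim_comp₂ h𝒜 (fun x y => |x - y|) (hf.simple n) (hf.simple k)
    have i2 := sim_comp₂ h𝒜 (fun x y => |x - y|) (hg.simple n) (hg.simple k)
    have i3 := sim_comp₂ h𝒜 (· + ·) i1 i2
    have hle := simIntegral_mono h𝒜 hν
      (sim_comp₂ h𝒜 (fun x y => |x - y|) (sim_comp₂ h𝒜 F (hf.simple n) (hg.simple n))
        (sim_comp₂ h𝒜 F (hf.simple k) (hg.simple k)))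
      (sim_comp h𝒜 (c * ·) i3) fun ω => hF _ _ _ _
    refine hle.trans_lt ?_
    rw [simIntegral_const_mul h𝒜 c i3, simIntegral_add h𝒜 i1 i2]
    calc _ < c * (ε / (2 * c) + ε / (2 * c)) :=
          mul_lt_mul_of_pos_left (add_lt_add
            (h₁ n (le_of_max_le_left hn) k (le_of_max_le_left hk))
            (h₂ n (le_of_max_le_right hn) k (le_of_max_le_right hk))) hc
      _ = ε := by field_simp; ring

theorem Determines.add (h𝒜 : IsSetAlgebra 𝒜) (hν : ∀ A ∈ 𝒜, 0 ≤ ν A) (hf : Determines ν s f)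
    (hg : Determines ν t g) : Determines ν (fun n ω => s n ω + t n ω) (fun ω => f ω + g ω) :=
  hf.comp₂ h𝒜 hν hg (· + ·) one_pos fun x y x' y' => by
    rw [one_mul, add_sub_add_comm]
    exact abs_add_le _ _

theorem Determines.sub (h𝒜 : IsSetAlgebra 𝒜) (hν : ∀ A ∈ 𝒜, 0 ≤ ν A) (hf : Determines ν s f)
    (hg : Determines ν t g) : Determines ν (fun n ω => s n ω - t n ω) (fun ω => f ω - g ω) :=
  hf.comp₂ h𝒜 hν hg (· - ·) one_pos fun x y x' y' => by
    rw [one_mul, sub_sub_sub_comm]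
    exact abs_sub _ _

theorem Determines.abs (h𝒜 : IsSetAlgebra 𝒜) (hν : ∀ A ∈ 𝒜, 0 ≤ ν A) (hf : Determines ν s f) :
    Determines ν (fun n ω => |s n ω|) (fun ω => |f ω|) :=
  hf.comp₂ h𝒜 hν hf (fun x _ => |x|) one_pos fun x y x' y' => by
    rw [one_mul]
    exact (abs_abs_sub_abs_le _ _).trans (le_add_of_nonneg_right (abs_nonneg _))

theorem Determines.const_mul (h𝒜 : IsSetAlgebra 𝒜) (hν : ∀ A ∈ 𝒜, 0 ≤ ν A) (c : ℝ)
    (hf : Determines ν s f) : Determines ν (fun n ω => c * s n ω) (fun ω => c * f ω) :=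
  hf.comp₂ h𝒜 hν hf (fun x _ => c * x) (c := |c| + 1) (by positivity) fun x y x' y' => by
    rw [← mul_sub, abs_mul]
    exact mul_le_mul (by linarith) (le_add_of_nonneg_right (abs_nonneg _)) (abs_nonneg _)
      (by positivity)

theorem Determines.of_sim (h𝒜 : IsSetAlgebra 𝒜) (hf : f ∈ Sim 𝒜) :
    Determines ν (fun _ => f) f where
  simple _ := hf
  measure ε hε η hη := ⟨0, fun _ _ => ⟨∅, h𝒜.empty_mem, by simp [hε.le], by simpa⟩⟩
  cauchy ε hε := ⟨0, fun _ _ _ _ => by simpa [simIntegral_zero]⟩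

/-- One sequence serves both contents, so their integrals can be compared along it. -/
theorem Determines.mono {m : AddContent ℝ 𝒜} (h𝒜 : IsSetAlgebra 𝒜) {c : ℝ} (hc : 0 < c)
    (h : ∀ A ∈ 𝒜, m A ≤ c * ν A) (hf : Determines ν s f) : Determines m s f where
  simple := hf.simple
  measure ε hε η hη := by
    obtain ⟨N, hN⟩ := hf.measure ε hε (η / c) (by positivity)
    refine ⟨N, fun n hn => ?_⟩
    obtain ⟨A, hA, hsA, hνA⟩ := hN n hn
    exact ⟨A, hA, hsA, (h A hA).trans_lt ((lt_div_iff₀' hc).1 hνA)⟩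
  cauchy ε hε := by
    obtain ⟨N, hN⟩ := hf.cauchy (ε / c) (by positivity)
    refine ⟨N, fun n hn k hk => ?_⟩
    exact (simIntegral_le_mul h (sim_comp₂ h𝒜 (fun x y => |x - y|) (hf.simple n) (hf.simple k))
      fun _ => abs_nonneg _).trans_lt ((lt_div_iff₀' hc).1 (hN n hn k hk))

theorem Determines.exists_tendsto (h𝒜 : IsSetAlgebra 𝒜) (hν : ∀ A ∈ 𝒜, 0 ≤ ν A)
    (hf : Determines ν s f) : ∃ I, Tendsto (fun n => simIntegral ν (s n)) atTop (𝓝 I) := by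
  refine cauchySeq_tendsto_of_complete (Metric.cauchySeq_iff.2 fun ε hε => ?_)
  obtain ⟨N, hN⟩ := hf.cauchy ε hε
  refine ⟨N, fun n hn k hk => ?_⟩
  rw [Real.dist_eq, ← simIntegral_sub h𝒜 (hf.simple n) (hf.simple k)]
  exact (abs_simIntegral_le h𝒜 hν
    (sim_comp₂ h𝒜 (· - ·) (hf.simple n) (hf.simple k))).trans_lt (hN n hn k hk)

/-- The difference of two determining sequences determines 0, so the integral does not depend on the
sequence. -/
theorem Determines.tendsto_sub (h𝒜 : IsSetAlgebra 𝒜) (hν : ∀ A ∈ 𝒜, 0 ≤ ν A)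
    (hf : Determines ν s f) (hg : Determines ν t f) :
    Tendsto (fun n => simIntegral ν (s n) - simIntegral ν (t n)) atTop (𝓝 0) := by
  have h := hf.sub h𝒜 hν hg
  simp only [sub_self] at h
  refine squeeze_zero_norm (fun n => ?_) (h.tendsto_zero h𝒜 hν)
  rw [Real.norm_eq_abs, ← simIntegral_sub h𝒜 (hf.simple n) (hg.simple n)]
  exact abs_simIntegral_le h𝒜 hν (sim_comp₂ h𝒜 (· - ·) (hf.simple n) (hg.simple n))

theorem Determines.tendsto_integral (h𝒜 : IsSetAlgebra 𝒜) (hν : ∀ A ∈ 𝒜, 0 ≤ ν A)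
    (hf : Determines ν s f) :
    Tendsto (fun n => simIntegral ν (s n)) atTop (𝓝 (integral 𝒜 ν f)) := by
  obtain ⟨I, hI⟩ := hf.exists_tendsto h𝒜 hν
  have h : ∃ I, HasIntegral 𝒜 ν f I :=
    ⟨I, s, (isDetermining_iff_of_nonneg h𝒜 hν).2 hf, hI⟩
  rw [integral, dif_pos h]
  obtain ⟨t, ht, hlim⟩ := h.choose_spec
  have := (hf.tendsto_sub h𝒜 hν ((isDetermining_iff_of_nonneg h𝒜 hν).1 ht)).add hlim
  simpa using this

theorem mem_L1_iff (h𝒜 : IsSetAlgebra 𝒜) (hν : ∀ A ∈ 𝒜, 0 ≤ ν A) :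
    f ∈ L1 𝒜 ν ↔ ∃ s, Determines ν s f :=
  exists_congr fun _ => isDetermining_iff_of_nonneg h𝒜 hν

theorem L1_add (h𝒜 : IsSetAlgebra 𝒜) (hν : ∀ A ∈ 𝒜, 0 ≤ ν A) (hf : f ∈ L1 𝒜 ν)
    (hg : g ∈ L1 𝒜 ν) : f + g ∈ L1 𝒜 ν := by
  rw [mem_L1_iff h𝒜 hν] at *
  obtain ⟨⟨s, hs⟩, t, ht⟩ := hf, hg
  exact ⟨_, hs.add h𝒜 hν ht⟩

theorem L1_smul (h𝒜 : IsSetAlgebra 𝒜) (hν : ∀ A ∈ 𝒜, 0 ≤ ν A) (c : ℝ) (hf : f ∈ L1 𝒜 ν) :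
    c • f ∈ L1 𝒜 ν := by
  rw [mem_L1_iff h𝒜 hν] at *
  obtain ⟨s, hs⟩ := hf
  exact ⟨_, hs.const_mul h𝒜 hν c⟩

theorem L1_abs (h𝒜 : IsSetAlgebra 𝒜) (hν : ∀ A ∈ 𝒜, 0 ≤ ν A) (hf : f ∈ L1 𝒜 ν) :
    (fun ω => |f ω|) ∈ L1 𝒜 ν := by
  rw [mem_L1_iff h𝒜 hν] at *
  obtain ⟨s, hs⟩ := hf
  exact ⟨_, hs.abs h𝒜 hν⟩

theorem L1_of_sim (h𝒜 : IsSetAlgebra 𝒜) (hν : ∀ A ∈ 𝒜, 0 ≤ ν A) (hf : f ∈ Sim 𝒜) :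
    f ∈ L1 𝒜 ν :=
  (mem_L1_iff h𝒜 hν).2 ⟨_, Determines.of_sim h𝒜 hf⟩

theorem integral_of_sim (h𝒜 : IsSetAlgebra 𝒜) (hν : ∀ A ∈ 𝒜, 0 ≤ ν A) (hf : f ∈ Sim 𝒜) :
    integral 𝒜 ν f = simIntegral ν f :=
  tendsto_nhds_unique ((Determines.of_sim h𝒜 hf).tendsto_integral h𝒜 hν) tendsto_const_nhds

theorem integral_add (h𝒜 : IsSetAlgebra 𝒜) (hν : ∀ A ∈ 𝒜, 0 ≤ ν A) (hf : f ∈ L1 𝒜 ν)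
    (hg : g ∈ L1 𝒜 ν) : integral 𝒜 ν (f + g) = integral 𝒜 ν f + integral 𝒜 ν g := by
  rw [mem_L1_iff h𝒜 hν] at *
  obtain ⟨⟨s, hs⟩, t, ht⟩ := hf, hg
  refine tendsto_nhds_unique ((hs.add h𝒜 hν ht).tendsto_integral h𝒜 hν) ?_
  simp only [simIntegral_add h𝒜 (hs.simple _) (ht.simple _)]
  exact (hs.tendsto_integral h𝒜 hν).add (ht.tendsto_integral h𝒜 hν)

theorem integral_smul (h𝒜 : IsSetAlgebra 𝒜) (hν : ∀ A ∈ 𝒜, 0 ≤ ν A) (c : ℝ)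
    (hf : f ∈ L1 𝒜 ν) : integral 𝒜 ν (c • f) = c * integral 𝒜 ν f := by
  rw [mem_L1_iff h𝒜 hν] at *
  obtain ⟨s, hs⟩ := hf
  refine tendsto_nhds_unique ((hs.const_mul h𝒜 hν c).tendsto_integral h𝒜 hν) ?_
  simp only [simIntegral_const_mul h𝒜 c (hs.simple _)]
  exact (hs.tendsto_integral h𝒜 hν).const_mul c

theorem L1_sub (h𝒜 : IsSetAlgebra 𝒜) (hν : ∀ A ∈ 𝒜, 0 ≤ ν A) (hf : f ∈ L1 𝒜 ν)
    (hg : g ∈ L1 𝒜 ν) : f - g ∈ L1 𝒜 ν := by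
  rw [sub_eq_add_neg, ← neg_one_smul ℝ g]
  exact L1_add h𝒜 hν hf (L1_smul h𝒜 hν _ hg)

theorem integral_sub (h𝒜 : IsSetAlgebra 𝒜) (hν : ∀ A ∈ 𝒜, 0 ≤ ν A) (hf : f ∈ L1 𝒜 ν)
    (hg : g ∈ L1 𝒜 ν) : integral 𝒜 ν (f - g) = integral 𝒜 ν f - integral 𝒜 ν g := by
  have := integral_add h𝒜 hν (L1_sub h𝒜 hν hf hg) hg
  rw [sub_add_cancel] at this
  linarith

theorem integral_nonneg (h𝒜 : IsSetAlgebra 𝒜) (hν : ∀ A ∈ 𝒜, 0 ≤ ν A) (hf : f ∈ L1 𝒜 ν)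
    (h : ∀ ω, 0 ≤ f ω) : 0 ≤ integral 𝒜 ν f := by
  rw [mem_L1_iff h𝒜 hν] at *
  obtain ⟨s, hs⟩ := hf
  have := hs.abs h𝒜 hν
  simp only [abs_of_nonneg (h _)] at this
  exact ge_of_tendsto' (this.tendsto_integral h𝒜 hν) fun n =>
    simIntegral_nonneg hν (this.simple n) fun _ => abs_nonneg _

theorem integral_mono (h𝒜 : IsSetAlgebra 𝒜) (hν : ∀ A ∈ 𝒜, 0 ≤ ν A) (hf : f ∈ L1 𝒜 ν)
    (hg : g ∈ L1 𝒜 ν) (h : ∀ ω, f ω ≤ g ω) : integral 𝒜 ν f ≤ integral 𝒜 ν g := by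
  rw [← sub_nonneg, ← integral_sub h𝒜 hν hg hf]
  exact integral_nonneg h𝒜 hν (L1_sub h𝒜 hν hg hf) fun ω => sub_nonneg.2 (h ω)

theorem L1_mono {m : AddContent ℝ 𝒜} (h𝒜 : IsSetAlgebra 𝒜) (hν : ∀ A ∈ 𝒜, 0 ≤ ν A)
    (hm : ∀ A ∈ 𝒜, 0 ≤ m A) {c : ℝ} (hc : 0 < c) (h : ∀ A ∈ 𝒜, m A ≤ c * ν A)
    (hf : f ∈ L1 𝒜 ν) : f ∈ L1 𝒜 m := by
  rw [mem_L1_iff h𝒜 hν] at hf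
  rw [mem_L1_iff h𝒜 hm]
  obtain ⟨s, hs⟩ := hf
  exact ⟨s, hs.mono h𝒜 hc h⟩

theorem integral_le_mul {m : AddContent ℝ 𝒜} (h𝒜 : IsSetAlgebra 𝒜) (hν : ∀ A ∈ 𝒜, 0 ≤ ν A)
    (hm : ∀ A ∈ 𝒜, 0 ≤ m A) {c : ℝ} (hc : 0 < c) (h : ∀ A ∈ 𝒜, m A ≤ c * ν A)
    (hf : f ∈ L1 𝒜 ν) (hf0 : ∀ ω, 0 ≤ f ω) : integral 𝒜 m f ≤ c * integral 𝒜 ν f := by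
  rw [mem_L1_iff h𝒜 hν] at hf
  obtain ⟨s, hs⟩ := hf
  have := hs.abs h𝒜 hν
  simp only [abs_of_nonneg (hf0 _)] at this
  exact le_of_tendsto_of_tendsto' ((this.mono h𝒜 hc h).tendsto_integral h𝒜 hm)
    ((this.tendsto_integral h𝒜 hν).const_mul c)
    fun n => simIntegral_le_mul h (this.simple n) fun _ => abs_nonneg _

/-- Density of simple functions: for fixed n, |s k - s n| determines |f - s n| as k grows, so the
Cauchy bound passes to the limit. -/
theorem Determines.tendsto_integral_abs_sub (h𝒜 : IsSetAlgebra 𝒜) (hν : ∀ A ∈ 𝒜, 0 ≤ ν A)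
    (hf : Determines ν s f) :
    Tendsto (fun n => integral 𝒜 ν fun ω => |f ω - s n ω|) atTop (𝓝 0) := by
  have hL : f ∈ L1 𝒜 ν := (mem_L1_iff h𝒜 hν).2 ⟨s, hf⟩
  rw [Metric.tendsto_atTop]
  intro ε hε
  obtain ⟨N, hN⟩ := hf.cauchy (ε / 2) (by positivity)
  refine ⟨N, fun n hn => ?_⟩
  have hs := L1_of_sim h𝒜 hν (hf.simple n)
  have h0 : 0 ≤ integral 𝒜 ν fun ω => |f ω - s n ω| :=
    integral_nonneg h𝒜 hν (L1_abs h𝒜 hν (L1_sub h𝒜 hν hL hs)) fun _ => abs_nonneg _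
  rw [Real.dist_0_eq_abs, abs_of_nonneg h0]
  refine lt_of_le_of_lt ?_ (half_lt_self hε)
  refine le_of_tendsto (((hf.sub h𝒜 hν (Determines.of_sim h𝒜 (hf.simple n))).abs
    h𝒜 hν).tendsto_integral h𝒜 hν) ?_
  filter_upwards [eventually_ge_atTop N] with k hk
  exact (hN k hk n hn).le

/-- A nonnegative integrable function with positive integral is bounded below by a positive
constant on a set of positive content. -/
theorem exists_le_of_integral_pos (h𝒜 : IsSetAlgebra 𝒜) (hν : ∀ A ∈ 𝒜, 0 ≤ ν A)
    (hf : f ∈ L1 𝒜 ν) (hf0 : ∀ ω, 0 ≤ f ω) (hpos : 0 < integral 𝒜 ν f) :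
    ∃ δ > 0, ∃ A ∈ 𝒜, 0 < ν A ∧ ∀ ω ∈ A, δ ≤ f ω := by
  by_contra! hcon
  have hnull : ∀ δ > 0, ∀ A ∈ 𝒜, (∀ ω ∈ A, δ ≤ f ω) → ν A = 0 := fun δ hδ A hA h => by
    refine le_antisymm (not_lt.1 fun hlt => ?_) (hν A hA)
    obtain ⟨ω, hω, hlt'⟩ := hcon δ hδ A hA hlt
    exact absurd (h ω hω) (not_le.2 hlt')
  obtain ⟨s, hs⟩ := (mem_L1_iff h𝒜 hν).1 hf
  -- Under the negation the zero sequence determines f, forcing integral 0. Level sets of f need not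
  -- lie in 𝒜, so {f > ε} is covered by B and {s N > 2ε/3} \ B; on the latter f ≥ ε/3, so it is
  -- null.
  have h0 : Determines ν (fun _ _ => 0) f := by
    refine ⟨fun _ => const_mem_sim h𝒜 0, fun ε hε η hη => ⟨0, fun _ _ => ?_⟩,
      fun ε hε => ⟨0, fun _ _ _ _ => by simpa [simIntegral_zero]⟩⟩
    obtain ⟨N, hN⟩ := hs.measure (ε / 3) (by positivity) η hη
    obtain ⟨B, hB, hsB, hνB⟩ := hN N le_rfl
    have hC : {ω | 2 * ε / 3 < s N ω} ∈ 𝒜 := setOf_mem_of_sim h𝒜 (hs.simple N) (2 * ε / 3 < ·)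
    have hCB := h𝒜.sdiff_mem hC hB
    have hz := hnull (ε / 3) (by positivity) _ hCB fun ω hω => by
      have h1 := (abs_le.1 (hsB ω hω.2)).2
      have h2 : 2 * ε / 3 < s N ω := hω.1
      linarith
    refine ⟨({ω | 2 * ε / 3 < s N ω} \ B) ∪ B, h𝒜.union_mem hCB hB, fun ω hω => ?_, ?_⟩
    · rw [zero_sub, abs_neg, abs_of_nonneg (hf0 ω)]
      rw [sdiff_union_self, mem_union, not_or] at hω
      have h1 := (abs_le.1 (hsB ω hω.2)).1
      have h2 : s N ω ≤ 2 * ε / 3 := not_lt.1 hω.1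
      linarith
    · linarith [content_union_le h𝒜 hν hCB hB]
  have := h0.tendsto_integral h𝒜 hν
  rw [simIntegral_zero] at this
  exact hpos.ne (tendsto_nhds_unique tendsto_const_nhds this)

end Integral

/-! ### Separation and countable combinations of functionals -/

section Separation

variable {E : Type*} [AddCommGroup E] [Module ℝ E]

/-- Separation of a point from a convex set at positive distance, for a single seminorm. -/
theorem exists_linearMap_separating (p : Seminorm ℝ E) {C : Set E} (hC : Convex ℝ C) {x : E}
    {ε : ℝ} (hε : 0 < ε) (h : ∀ g ∈ C, ε ≤ p (x - g)) :
    ∃ φ : E →ₗ[ℝ] ℝ, (∃ c ≥ 0, ∀ f, |φ f| ≤ c * p f) ∧ ∃ u, (∀ g ∈ C, φ g < u) ∧ u < φ x := by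
  -- Hahn–Banach separation does not need a Hausdorff space, so no quotient by null vectors is
  -- taken.
  let _ : SeminormedAddCommGroup E := p.toAddGroupSeminorm.toSeminormedAddCommGroup
  have hnorm : ∀ y : E, ‖y‖ = p y := fun _ => rfl
  let _ : NormedSpace ℝ E := ⟨fun a b => by rw [hnorm, hnorm, map_smul_eq_mul]⟩
  have hx : x ∉ closure C := fun hx => by
    obtain ⟨g, hg, hlt⟩ := Metric.mem_closure_iff.1 hx ε hε
    rw [dist_eq_norm, hnorm] at hlt
    exact absurd (h g hg) (not_le.2 hlt)
  obtain ⟨φ, u, hu, hxu⟩ := geometric_hahn_banach_closed_point hC.closure isClosed_closure hx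
  exact ⟨φ, ⟨‖φ‖, norm_nonneg _, φ.le_opNorm⟩, u, fun g hg => hu g (subset_closure hg), hxu⟩

/-- A countable family of dominated functionals, each bounded above on `K`, has a convergent
combination with positive coefficients that is again dominated and bounded above on `K`. -/
theorem exists_hasSum_smul (p : Seminorm ℝ E) (K : Set E) (φ : ℕ → E →ₗ[ℝ] ℝ)
    (hφ : ∀ n, ∃ c ≥ 0, ∀ f, |φ n f| ≤ c * p f) (hK : ∀ n, ∃ S, ∀ k ∈ K, φ n k ≤ S) :
    ∃ (a : ℕ → ℝ) (ψ : E →ₗ[ℝ] ℝ), (∀ n, 0 < a n) ∧ (∀ f, HasSum (fun n => a n * φ n f) (ψ f)) ∧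
      (∃ c ≥ 0, ∀ f, |ψ f| ≤ c * p f) ∧ ∃ S, ∀ k ∈ K, ψ k ≤ S := by
  choose c hc0 hc using hφ
  choose S hS using hK
  have hpos : ∀ n, 0 < 1 + c n + |S n| := fun n => by linarith [hc0 n, abs_nonneg (S n)]
  -- The denominator bounds both a n * c n and a n * S n by 2⁻ⁿ, so the series is dominated by 2p
  -- and its sum is at most 2 on K.
  set a : ℕ → ℝ := fun n => (1 / 2) ^ n / (1 + c n + |S n|) with ha
  have ha0 : ∀ n, 0 < a n := fun n => div_pos (by positivity) (hpos n)
  have hle : ∀ n t, t ≤ 1 + c n + |S n| → a n * t ≤ (1 / 2) ^ n := fun n t ht => by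
    rw [ha, div_mul_eq_mul_div, div_le_iff₀ (hpos n)]
    exact mul_le_mul_of_nonneg_left ht (by positivity)
  have hterm : ∀ n f, |a n * φ n f| ≤ (1 / 2) ^ n * p f := fun n f => by
    rw [abs_mul, abs_of_pos (ha0 n)]
    calc a n * |φ n f| ≤ a n * (c n * p f) := mul_le_mul_of_nonneg_left (hc n f) (ha0 n).le
      _ = a n * c n * p f := (mul_assoc _ _ _).symm
      _ ≤ _ := mul_le_mul_of_nonneg_right (hle n _ (by linarith [abs_nonneg (S n)]))
        (apply_nonneg p f)
  have hsum : ∀ f, Summable fun n => a n * φ n f := fun f =>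
    Summable.of_norm_bounded (summable_geometric_two.mul_right (p f)) fun n => hterm n f
  let ψ : E →ₗ[ℝ] ℝ :=
    { toFun f := ∑' n, a n * φ n f
      map_add' f g := by
        simp only [map_add, mul_add]
        exact (hsum f).tsum_add (hsum g)
      map_smul' r f := by
        simp only [map_smul, smul_eq_mul, RingHom.id_apply, mul_left_comm _ r]
        exact tsum_mul_left }
  have hψ : ∀ f, HasSum (fun n => a n * φ n f) (ψ f) := fun f => (hsum f).hasSum
  refine ⟨a, ψ, ha0, hψ, ⟨2, two_pos.le, fun f => ?_⟩, 2, fun k hk => ?_⟩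
  · exact (hψ f).norm_le_of_bounded (hasSum_geometric_two.mul_right (p f)) fun n => hterm n f
  · refine hasSum_le (fun n => ?_) (hψ k) hasSum_geometric_two
    exact (mul_le_mul_of_nonneg_left (hS n k hk) (ha0 n).le).trans
      (hle n _ (by linarith [hc0 n, le_abs_self (S n)]))

end Separation

/-! ### Exhaustion without countable additivity -/

section Exhaustion

/-- Exhaustion: if a class of contents is stable under sums and under countable combinations,
and every set of positive `ν`-content is charged by a member of the class dominated by `ν`, then
one member of the class charges all of these sets. -/
theorem exists_charging_content (h𝒜 : IsSetAlgebra 𝒜) {ν : AddContent ℝ 𝒜}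
    (hν : ∀ A ∈ 𝒜, 0 ≤ ν A) {ι : Type*} {M : Set ι} (m : ι → AddContent ℝ 𝒜)
    (hne : M.Nonempty)
    (hm : ∀ i ∈ M, ∀ A ∈ 𝒜, 0 ≤ m i A)
    (hadd : ∀ i ∈ M, ∀ j ∈ M, ∃ k ∈ M, ∀ A ∈ 𝒜, m k A = m i A + m j A)
    (hcount : ∀ i : ℕ → ι, (∀ n, i n ∈ M) → ∃ k ∈ M, ∀ A ∈ 𝒜, m k A = 0 → ∀ n, m (i n) A = 0)
    (hcharge : ∀ A ∈ 𝒜, 0 < ν A → ∃ i ∈ M, 0 < m i A ∧ ∀ B ∈ 𝒜, m i B ≤ ν B) :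
    ∃ i ∈ M, ∀ A ∈ 𝒜, m i A = 0 → ν A = 0 := by
  -- The infimum of V i is the total mass of the lattice infimum of m i and ν. It is at most ν(Ω),
  -- and measures how much of ν is charged by m i.
  let V : ι → Set ℝ := fun i => {r | ∃ B ∈ 𝒜, r = m i B + ν Bᶜ}
  have hVne : ∀ i, (V i).Nonempty := fun i => ⟨_, univ, h𝒜.univ_mem, rfl⟩
  have hVbdd : ∀ i ∈ M, BddBelow (V i) := fun i hi => ⟨0, by
    rintro _ ⟨B, hB, rfl⟩
    exact add_nonneg (hm i hi B hB) (hν _ (h𝒜.compl_mem hB))⟩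
  let J : ι → ℝ := fun i => sInf (V i)
  have hJle : ∀ i ∈ M, ∀ B ∈ 𝒜, J i ≤ m i B + ν Bᶜ := fun i hi B hB =>
    csInf_le (hVbdd i hi) ⟨B, hB, rfl⟩
  have hbdd : BddAbove (J '' M) := ⟨ν univ, by
    rintro _ ⟨i, hi, rfl⟩
    simpa using hJle i hi ∅ h𝒜.empty_mem⟩
  have hseq : ∀ n : ℕ, ∃ i ∈ M, sSup (J '' M) - 1 / (n + 1) < J i := fun n => by
    obtain ⟨_, ⟨i, hi, rfl⟩, hlt⟩ := exists_lt_of_lt_csSup (hne.image J)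
      (sub_lt_self (sSup (J '' M)) (Nat.one_div_pos_of_nat (n := n)))
    exact ⟨i, hi, hlt⟩
  choose i hiM hi using hseq
  obtain ⟨k, hk, hk0⟩ := hcount i hiM
  refine ⟨k, hk, fun A hA hkA => le_antisymm (not_lt.1 fun hpos => ?_) (hν A hA)⟩
  obtain ⟨j, hj, hjA, hjν⟩ := hcharge A hA hpos
  -- A is null for every m (i n), so adding m j raises J by at least m j A: replace B by B ∪ A in
  -- the bound for i n, and use m j ≤ ν on A \ B. Along the maximising sequence this pushes J above
  -- its supremum.
  have hstep : ∀ n, J (i n) + m j A ≤ sSup (J '' M) := fun n => by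
    obtain ⟨l, hl, hlm⟩ := hadd (i n) (hiM n) j hj
    refine le_trans (le_csInf (hVne l) ?_) (le_csSup hbdd ⟨l, hl, rfl⟩)
    rintro _ ⟨B, hB, rfl⟩
    have hAB := h𝒜.inter_mem hB hA
    have hdiff := h𝒜.sdiff_mem hA hB
    have h1 := hJle (i n) (hiM n) (B ∪ A) (h𝒜.union_mem hB hA)
    have h2 := content_union_le h𝒜 (hm _ (hiM n)) hB hA
    rw [hk0 A hA hkA n, add_zero] at h2
    have h3 : m j A ≤ m j B + ν (A \ B) := by
      have e := addContent_union (m := m j) h𝒜.isSetRing hAB hdiff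
        (disjoint_sdiff_right.mono_left inter_subset_left)
      rw [inter_comm, inter_union_sdiff] at e
      have := content_mono h𝒜 (hm j hj) hAB hB inter_subset_left
      rw [inter_comm] at this
      linarith [hjν _ hdiff]
    have h4 : ν Bᶜ = ν (B ∪ A)ᶜ + ν (A \ B) := by
      rw [← addContent_union h𝒜.isSetRing (h𝒜.compl_mem (h𝒜.union_mem hB hA)) hdiff]
      · congr 1
        ext ω
        simp only [mem_compl_iff, mem_union, Set.mem_sdiff]
        tauto
      · exact (disjoint_compl_left_iff_subset.2 (sdiff_subset.trans subset_union_right))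
    rw [hlm B hB]
    linarith
  have hlim : Tendsto (fun n : ℕ => sSup (J '' M) - 1 / ((n : ℝ) + 1) + m j A) atTop
      (𝓝 (sSup (J '' M) - 0 + m j A)) :=
    (tendsto_one_div_add_atTop_nhds_zero_nat.const_sub _).add_const _
  have := le_of_tendsto' hlim fun n => (add_le_add_left (hi n).le _).trans (hstep n)
  linarith

end Exhaustion

/-! ### Functionals on L¹ and their contents -/

theorem indicator_one_mem_sim (h𝒜 : IsSetAlgebra 𝒜) {A : Set Ω} (hA : A ∈ 𝒜) :
    A.indicator (1 : Ω → ℝ) ∈ Sim 𝒜 :=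
  indicator_const_mem_sim h𝒜 hA 1

theorem integral_indicator_one (h𝒜 : IsSetAlgebra 𝒜) {ν : AddContent ℝ 𝒜}
    (hν : ∀ A ∈ 𝒜, 0 ≤ ν A) {A : Set Ω} (hA : A ∈ 𝒜) :
    integral 𝒜 ν (A.indicator (1 : Ω → ℝ)) = ν A := by
  rw [integral_of_sim h𝒜 hν (indicator_one_mem_sim h𝒜 hA)]
  exact (simIntegral_indicator_const h𝒜 hA 1).trans (one_mul _)

section Functionals

variable (h𝒜 : IsSetAlgebra 𝒜) {ν : AddContent ℝ 𝒜} (hν : ∀ A ∈ 𝒜, 0 ≤ ν A)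

/-- `L¹(ν)` as a vector space of functions. -/
def L1Submodule : Submodule ℝ (Ω → ℝ) where
  carrier := L1 𝒜 ν
  add_mem' hf hg := L1_add h𝒜 hν hf hg
  zero_mem' := L1_of_sim h𝒜 hν (const_mem_sim h𝒜 0)
  smul_mem' c _ hf := L1_smul h𝒜 hν c hf

/-- The seminorm `∫ |f| dν` on `L¹(ν)`. -/
def L1Seminorm : Seminorm ℝ (L1Submodule h𝒜 hν) :=
  Seminorm.of (fun f => integral 𝒜 ν fun ω => |(f : Ω → ℝ) ω|)
    (fun f g => by
      have hf := L1_abs h𝒜 hν f.2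
      have hg := L1_abs h𝒜 hν g.2
      exact (integral_mono h𝒜 hν (L1_abs h𝒜 hν (f + g).2) (L1_add h𝒜 hν hf hg)
        fun ω => abs_add_le _ _).trans_eq (integral_add h𝒜 hν hf hg))
    (fun c f => by
      rw [Real.norm_eq_abs, ← integral_smul h𝒜 hν |c| (L1_abs h𝒜 hν f.2)]
      congr 1
      ext ω
      simp [abs_mul])

theorem L1Seminorm_apply (f : L1Submodule h𝒜 hν) :
    L1Seminorm h𝒜 hν f = integral 𝒜 ν fun ω => |(f : Ω → ℝ) ω| := rfl

/-- The indicator of a set of the algebra, as an element of `L¹(ν)`. -/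
def ind {A : Set Ω} (hA : A ∈ 𝒜) : L1Submodule h𝒜 hν :=
  ⟨A.indicator 1, L1_of_sim h𝒜 hν (indicator_one_mem_sim h𝒜 hA)⟩

theorem L1Seminorm_ind {A : Set Ω} (hA : A ∈ 𝒜) :
    L1Seminorm h𝒜 hν (ind h𝒜 hν hA) = ν A := by
  rw [L1Seminorm_apply, ← integral_indicator_one h𝒜 hν hA]
  congr 1
  ext ω
  exact abs_of_nonneg (indicator_nonneg (fun _ _ => zero_le_one) ω)

open scoped Classical in
/-- The content `A ↦ φ(1_A)` of a linear functional `φ` on `L¹(ν)`. -/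
def contentOf (φ : L1Submodule h𝒜 hν →ₗ[ℝ] ℝ) : AddContent ℝ 𝒜 :=
  h𝒜.isSetRing.addContent_of_union (fun A => if hA : A ∈ 𝒜 then φ (ind h𝒜 hν hA) else 0)
    (by
      rw [dif_pos h𝒜.empty_mem, ← map_zero φ]
      congr 1
      exact Subtype.ext (indicator_empty _))
    (fun {A B} hA hB hAB => by
      rw [dif_pos hA, dif_pos hB, dif_pos (h𝒜.union_mem hA hB), ← map_add]
      congr 1
      exact Subtype.ext (indicator_union_of_disjoint hAB _))

theorem contentOf_apply (φ : L1Submodule h𝒜 hν →ₗ[ℝ] ℝ) {A : Set Ω} (hA : A ∈ 𝒜) :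
    contentOf h𝒜 hν φ A = φ (ind h𝒜 hν hA) :=
  dif_pos hA

theorem simIntegral_contentOf (φ : L1Submodule h𝒜 hν →ₗ[ℝ] ℝ) {f : L1Submodule h𝒜 hν}
    (hf : (f : Ω → ℝ) ∈ Sim 𝒜) : simIntegral (contentOf h𝒜 hν φ) f = φ f := by
  have h : f = ∑ x ∈ hf.1.toFinset, x • ind h𝒜 hν (hf.2 x) := by
    refine Subtype.ext ((sim_eq_sum_indicator hf).trans ?_)
    rw [Submodule.coe_sum]
    rfl
  conv_rhs => rw [h]
  rw [simIntegral, finsum_mem_eq_finite_toFinset_sum _ hf.1, map_sum]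
  refine Finset.sum_congr rfl fun x _ => ?_
  rw [map_smul, contentOf_apply h𝒜 hν φ (hf.2 x), smul_eq_mul]

theorem contentOf_le {φ : L1Submodule h𝒜 hν →ₗ[ℝ] ℝ} {c : ℝ}
    (hφ : ∀ f, |φ f| ≤ c * L1Seminorm h𝒜 hν f) :
    ∀ A ∈ 𝒜, contentOf h𝒜 hν φ A ≤ c * ν A := fun A hA => by
  rw [contentOf_apply h𝒜 hν φ hA, ← L1Seminorm_ind h𝒜 hν hA]
  exact (le_abs_self _).trans (hφ _)

/-- A positive dominated functional on `L¹(ν)` is the integral with respect to its content. -/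
theorem integral_contentOf {φ : L1Submodule h𝒜 hν →ₗ[ℝ] ℝ} {c : ℝ} (hc : 0 < c)
    (hφ : ∀ f, |φ f| ≤ c * L1Seminorm h𝒜 hν f) (hpos : ∀ A ∈ 𝒜, 0 ≤ contentOf h𝒜 hν φ A)
    (f : L1Submodule h𝒜 hν) : integral 𝒜 (contentOf h𝒜 hν φ) f = φ f := by
  obtain ⟨s, hs⟩ := (mem_L1_iff h𝒜 hν).1 f.2
  let S : ℕ → L1Submodule h𝒜 hν := fun n => ⟨s n, L1_of_sim h𝒜 hν (hs.simple n)⟩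
  -- Domination makes s determining for the content of φ as well, and forces φ (S n) → φ f.
  refine tendsto_nhds_unique
    ((hs.mono h𝒜 hc (contentOf_le h𝒜 hν hφ)).tendsto_integral h𝒜 hpos) ?_
  have hS : ∀ n, simIntegral (contentOf h𝒜 hν φ) (s n) = φ (S n) := fun n =>
    simIntegral_contentOf h𝒜 hν φ (f := S n) (hs.simple n)
  simp only [hS]
  rw [tendsto_iff_norm_sub_tendsto_zero]
  refine squeeze_zero (fun _ => norm_nonneg _) (fun n => ?_)
    (by simpa using (hs.tendsto_integral_abs_sub h𝒜 hν).const_mul c)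
  rw [norm_sub_rev, Real.norm_eq_abs, ← map_sub]
  exact hφ _

end Functionals

/-! ### Functionals separating from K - Sim₊ -/

theorem zero_mem_simPos (h𝒜 : IsSetAlgebra 𝒜) : (0 : Ω → ℝ) ∈ SimPos 𝒜 :=
  ⟨const_mem_sim h𝒜 0, fun _ => le_rfl⟩

theorem convex_simPos (h𝒜 : IsSetAlgebra 𝒜) : Convex ℝ (SimPos 𝒜 : Set (Ω → ℝ)) := by
  intro f hf g hg a b ha hb _
  exact ⟨sim_comp₂ h𝒜 (fun x y => a * x + b * y) hf.1 hg.1, fun ω =>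
    add_nonneg (mul_nonneg ha (hf.2 ω)) (mul_nonneg hb (hg.2 ω))⟩

section Separating

variable {ν : AddContent ℝ 𝒜} {K : Set (Ω → ℝ)}

/-- If a multiple of `1_A` is not in the closure of `K - Sim₊`, some positive dominated functional
bounded above on `K` charges `A`. -/
theorem exists_functional_charging (h𝒜 : IsSetAlgebra 𝒜) (hν : ∀ A ∈ 𝒜, 0 ≤ ν A)
    (hKconv : Convex ℝ K) (hK0 : 0 ∈ K) {A : Set Ω} (hA : A ∈ 𝒜) {d ε : ℝ} (hd : 0 < d)
    (hε : 0 < ε) (hfar : ∀ g ∈ K - SimPos 𝒜, g ∈ L1 𝒜 ν →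
      ε ≤ integral 𝒜 ν fun ω => |(d • A.indicator (1 : Ω → ℝ)) ω - g ω|) :
    ∃ φ : L1Submodule h𝒜 hν →ₗ[ℝ] ℝ, (∃ c ≥ 0, ∀ f, |φ f| ≤ c * L1Seminorm h𝒜 hν f) ∧
      (∀ B, ∀ hB : B ∈ 𝒜, 0 ≤ φ (ind h𝒜 hν hB)) ∧
      (∃ S, ∀ k : L1Submodule h𝒜 hν, (k : Ω → ℝ) ∈ K → φ k ≤ S) ∧ 0 < φ (ind h𝒜 hν hA) := by
  have hconv : Convex ℝ ((L1Submodule h𝒜 hν).subtype ⁻¹' (K - SimPos 𝒜)) :=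
    (hKconv.sub (convex_simPos h𝒜)).linear_preimage _
  obtain ⟨φ, hφ, u, hu, hxu⟩ := exists_linearMap_separating (L1Seminorm h𝒜 hν) hconv
    (x := d • ind h𝒜 hν hA) hε fun g hg => hfar g hg g.2
  have hu0 : 0 < u := by
    have := hu 0 (Set.mem_preimage.2 ⟨0, hK0, 0, zero_mem_simPos h𝒜, by simp⟩)
    rwa [map_zero] at this
  refine ⟨φ, hφ, fun B hB => ?_, ⟨u, fun k hk => ?_⟩, ?_⟩
  -- If φ(1_B) < 0, the multiple of 1_B with φ-value exactly u has a nonpositive coefficient, so it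
  -- lies in -Sim₊, where φ < u.
  · by_contra! hneg
    have hlt := hu ((u / φ (ind h𝒜 hν hB)) • ind h𝒜 hν hB) (Set.mem_preimage.2
      ⟨0, hK0, -((u / φ (ind h𝒜 hν hB)) • B.indicator (1 : Ω → ℝ)), ?_, by
        simp only [zero_sub, neg_neg]
        rfl⟩)
    · rw [map_smul, smul_eq_mul, div_mul_cancel₀ _ hneg.ne] at hlt
      exact lt_irrefl _ hlt
    · refine ⟨sim_comp h𝒜 (fun x => -(u / φ (ind h𝒜 hν hB) * x))
        (indicator_one_mem_sim h𝒜 hB), fun ω => ?_⟩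
      exact neg_nonneg.2 (mul_nonpos_of_nonpos_of_nonneg
        (div_nonpos_of_nonneg_of_nonpos hu0.le hneg.le)
        (indicator_nonneg (fun _ _ => zero_le_one) ω))
  · exact (hu k (Set.mem_preimage.2 ⟨k, hk, 0, zero_mem_simPos h𝒜, by simp⟩)).le
  · rw [map_smul, smul_eq_mul] at hxu
    exact pos_of_mul_pos_right (hu0.trans hxu) hd.le

/-- The functionals obtained by separating each charged set combine into a single one charging
all of them. -/
theorem exists_equivalent_functional (h𝒜 : IsSetAlgebra 𝒜) (hν : ∀ A ∈ 𝒜, 0 ≤ ν A)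
    (hex : ∀ A, ∀ hA : A ∈ 𝒜, 0 < ν A →
      ∃ φ : L1Submodule h𝒜 hν →ₗ[ℝ] ℝ, (∃ c ≥ 0, ∀ f, |φ f| ≤ c * L1Seminorm h𝒜 hν f) ∧
      (∀ B, ∀ hB : B ∈ 𝒜, 0 ≤ φ (ind h𝒜 hν hB)) ∧
      (∃ S, ∀ k : L1Submodule h𝒜 hν, (k : Ω → ℝ) ∈ K → φ k ≤ S) ∧ 0 < φ (ind h𝒜 hν hA)) :
    ∃ φ : L1Submodule h𝒜 hν →ₗ[ℝ] ℝ, (∃ c ≥ 0, ∀ f, |φ f| ≤ c * L1Seminorm h𝒜 hν f) ∧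
      (∀ B, ∀ hB : B ∈ 𝒜, 0 ≤ φ (ind h𝒜 hν hB)) ∧
      (∃ S, ∀ k : L1Submodule h𝒜 hν, (k : Ω → ℝ) ∈ K → φ k ≤ S) ∧
      ∀ A, ∀ hA : A ∈ 𝒜, φ (ind h𝒜 hν hA) = 0 → ν A = 0 := by
  let M : Set (L1Submodule h𝒜 hν →ₗ[ℝ] ℝ) :=
    {φ | (∃ c ≥ 0, ∀ f, |φ f| ≤ c * L1Seminorm h𝒜 hν f) ∧
      (∀ B, ∀ hB : B ∈ 𝒜, 0 ≤ φ (ind h𝒜 hν hB)) ∧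
      ∃ S, ∀ k : L1Submodule h𝒜 hν, (k : Ω → ℝ) ∈ K → φ k ≤ S}
  suffices h : ∃ φ ∈ M, ∀ A ∈ 𝒜, contentOf h𝒜 hν φ A = 0 → ν A = 0 by
    obtain ⟨φ, hφ, h0⟩ := h
    refine ⟨φ, hφ.1, hφ.2.1, hφ.2.2, fun A hA h => h0 A hA ?_⟩
    rwa [contentOf_apply h𝒜 hν φ hA]
  refine exists_charging_content h𝒜 hν (M := M) (contentOf h𝒜 hν)
    ⟨0, ⟨0, le_rfl, by simp⟩, by simp, 0, by simp⟩
    (fun φ hφ A hA => (contentOf_apply h𝒜 hν φ hA).symm ▸ hφ.2.1 A hA) ?_ ?_ ?_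
  · rintro φ ⟨⟨c, hc0, hc⟩, hφ, S, hS⟩ ψ ⟨⟨c', hc0', hc'⟩, hψ, S', hS'⟩
    refine ⟨φ + ψ, ⟨⟨c + c', add_nonneg hc0 hc0', fun f => ?_⟩,
      fun B hB => add_nonneg (hφ B hB) (hψ B hB), S + S', fun k hk =>
      add_le_add (hS k hk) (hS' k hk)⟩, fun A hA => ?_⟩
    · rw [add_mul]
      exact (abs_add_le _ _).trans (add_le_add (hc f) (hc' f))
    · simp only [contentOf_apply h𝒜 hν _ hA, LinearMap.add_apply]
  · intro φ hφ
    obtain ⟨a, ψ, ha, hsum, hc, S, hS⟩ := exists_hasSum_smul (L1Seminorm h𝒜 hν)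
      {k | (k : Ω → ℝ) ∈ K} φ (fun n => (hφ n).1) (fun n => (hφ n).2.2)
    have hnn : ∀ n B, ∀ hB : B ∈ 𝒜, 0 ≤ a n * φ n (ind h𝒜 hν hB) := fun n B hB =>
      mul_nonneg (ha n).le ((hφ n).2.1 B hB)
    refine ⟨ψ, ⟨hc, fun B hB => (hsum _).nonneg fun n => hnn n B hB, S, hS⟩, fun A hA h n => ?_⟩
    rw [contentOf_apply h𝒜 hν _ hA] at h ⊢
    have hs := hsum (ind h𝒜 hν hA)
    rw [h, hasSum_zero_iff_of_nonneg fun n => hnn n A hA] at hs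
    exact (mul_eq_zero.1 (congrFun hs n)).resolve_left (ha n).ne'
  · intro A hA hpos
    obtain ⟨φ, ⟨c, hc0, hc⟩, hφ, ⟨S, hS⟩, hφA⟩ := hex A hA hpos
    -- Rescaling makes the content at most ν, as the exhaustion requires; c itself may be 0.
    have hc1 : 0 < c + 1 := by linarith
    have hbd : ∀ f, |((c + 1)⁻¹ • φ) f| ≤ 1 * L1Seminorm h𝒜 hν f := fun f => by
      rw [LinearMap.smul_apply, smul_eq_mul, abs_mul, abs_of_pos (inv_pos.2 hc1), one_mul,
        inv_mul_le_iff₀ hc1]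
      exact (hc f).trans (mul_le_mul_of_nonneg_right (by linarith) (apply_nonneg _ f))
    refine ⟨(c + 1)⁻¹ • φ, ⟨⟨1, zero_le_one, hbd⟩, fun B hB =>
      mul_nonneg (inv_pos.2 hc1).le (hφ B hB), (c + 1)⁻¹ * S, fun k hk =>
      mul_le_mul_of_nonneg_left (hS k hk) (inv_pos.2 hc1).le⟩, ?_, fun B hB => ?_⟩
    · rw [contentOf_apply h𝒜 hν _ hA]
      exact mul_pos (inv_pos.2 hc1) hφA
    · simpa using contentOf_le h𝒜 hν hbd B hB

/-- An element of the closure of `K - Sim₊` has integral at most `S` with respect to every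
dominated nonnegative content for which the integrals over `K` are at most `S`. -/
theorem integral_le_of_mem_closure (h𝒜 : IsSetAlgebra 𝒜) (hν : ∀ A ∈ 𝒜, 0 ≤ ν A)
    {m : AddContent ℝ 𝒜} (hm : ∀ A ∈ 𝒜, 0 ≤ m A) {c : ℝ} (hc : 0 < c)
    (hmν : ∀ A ∈ 𝒜, m A ≤ c * ν A) (hK : K ⊆ L1 𝒜 m) {S : ℝ}
    (hS : ∀ k ∈ K, integral 𝒜 m k ≤ S) {f : Ω → ℝ} (hf : f ∈ L1 𝒜 ν)
    (hcl : ∀ ε : ℝ, 0 < ε → ∃ g ∈ K - SimPos 𝒜, g ∈ L1 𝒜 ν ∧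
      integral 𝒜 ν (fun ω => |f ω - g ω|) < ε) : integral 𝒜 m f ≤ S := by
  refine le_of_forall_pos_le_add fun ε hε => ?_
  -- With g = k - t: m(f) ≤ m(k) - m(t) + m(|f - g|) ≤ S + c·ν(|f - g|).
  obtain ⟨g, ⟨k, hk, t, ht, rfl⟩, hg, hlt⟩ := hcl (ε / c) (by positivity)
  have hfm := L1_mono h𝒜 hν hm hc hmν hf
  have hgm := L1_mono h𝒜 hν hm hc hmν hg
  have htm := L1_of_sim h𝒜 hm ht.1
  have hab := L1_abs h𝒜 hν (L1_sub h𝒜 hν hf hg)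
  have h1 : integral 𝒜 m (f - (k - t)) ≤ integral 𝒜 m fun ω => |(f - (k - t)) ω| :=
    integral_mono h𝒜 hm (L1_sub h𝒜 hm hfm hgm) (L1_abs h𝒜 hm (L1_sub h𝒜 hm hfm hgm))
      fun ω => le_abs_self _
  have h2 := integral_le_mul h𝒜 hν hm hc hmν hab fun ω => abs_nonneg _
  have h3 : c * integral 𝒜 ν (fun ω => |(f - (k - t)) ω|) < ε := (lt_div_iff₀' hc).1 hlt
  rw [integral_sub h𝒜 hm hfm hgm, integral_sub h𝒜 hm (hK hk) htm] at h1
  linarith [hS k hk, integral_nonneg h𝒜 hm htm ht.2]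

end Separating

end

end FinAdd

/-! ### The equivalence -/

theorem L1_eq_L1_variation {Ω : Type*} {𝒜 : Set (Set Ω)} (h𝒜 : IsSetAlgebra 𝒜)
    {μ : AddContent ℝ 𝒜} (hμ : FinAdd.IsBoundedOn 𝒜 μ) :
    FinAdd.L1 𝒜 μ = FinAdd.L1 𝒜 (FinAdd.variation h𝒜 μ hμ) := by
  have hν := FinAdd.variation_nonneg h𝒜 hμ
  ext f
  rw [FinAdd.mem_L1_iff h𝒜 hν]
  exact exists_congr fun s => FinAdd.isDetermining_iff h𝒜 hν fun _ _ => rfl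

theorem corollary6p2 {Ω : Type*} (𝒜 : Set (Set Ω)) (h𝒜 : IsSetAlgebra 𝒜)
    (lam : AddContent ℝ 𝒜) (hlam : FinAdd.IsBoundedOn 𝒜 lam)
    (hlam0 : ∃ A ∈ 𝒜, lam A ≠ 0)
    (K : Set (Ω → ℝ)) (hKL1 : K ⊆ FinAdd.L1 𝒜 lam) (hKconv : Convex ℝ K) (hK0 : 0 ∈ K) :
    List.TFAE [
      ∀ f ∈ FinAdd.L1 𝒜 lam, (∀ ω, 0 ≤ f ω) →
        0 < FinAdd.integral 𝒜 (FinAdd.totalVar 𝒜 lam) f →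
        ∃ η : ℝ, 0 < η ∧ η • f ∉ FinAdd.L1closure 𝒜 lam (K - FinAdd.SimPos 𝒜),
      ∀ A ∈ 𝒜, 0 < FinAdd.totalVar 𝒜 lam A →
        ∃ d : ℝ, 0 < d ∧
          d • A.indicator (1 : Ω → ℝ) ∉ FinAdd.L1closure 𝒜 lam (K - FinAdd.SimPos 𝒜),
      ∃ m : AddContent ℝ 𝒜, FinAdd.IsProb 𝒜 m ∧
        (K ⊆ FinAdd.L1 𝒜 m ∧ BddAbove (FinAdd.integral 𝒜 m '' K)) ∧
        (∃ c : ℝ, 0 < c ∧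
          ∀ A ∈ 𝒜, FinAdd.totalVar 𝒜 m A ≤ c * FinAdd.totalVar 𝒜 lam A) ∧
        (∀ A ∈ 𝒜, m A = 0 ↔ FinAdd.totalVar 𝒜 lam A = 0)] := by

  have hL1 := L1_eq_L1_variation h𝒜 hlam
  have hν := FinAdd.variation_nonneg h𝒜 hlam
  rw [hL1] at hKL1
  simp only [FinAdd.L1closure, hL1, ← FinAdd.coe_variation h𝒜 hlam]
  -- From here on λ matters only through ν, except that λ ≠ 0 is needed for ν(Ω) > 0.
  generalize hνdef : FinAdd.variation h𝒜 lam hlam = ν at *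
  tfae_have 1 → 2 := fun h A hA hpos =>
    h _ (FinAdd.L1_of_sim h𝒜 hν (FinAdd.indicator_one_mem_sim h𝒜 hA))
      (indicator_nonneg fun _ _ => zero_le_one)
      (by rwa [FinAdd.integral_indicator_one h𝒜 hν hA])
  tfae_have 2 → 3 := by
    intro h
    obtain ⟨φ, ⟨c, hc0, hc⟩, hpos, ⟨S, hS⟩, hnull⟩ :=
      FinAdd.exists_equivalent_functional h𝒜 hν (K := K) fun A hA hνA => by
        obtain ⟨d, hd, hmem⟩ := h A hA hνA
        rw [mem_ofPred_eq, not_and] at hmem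
        have hmem := hmem (FinAdd.L1_smul h𝒜 hν d
          (FinAdd.L1_of_sim h𝒜 hν (FinAdd.indicator_one_mem_sim h𝒜 hA)))
        push Not at hmem
        obtain ⟨ε, hε, hfar⟩ := hmem
        exact FinAdd.exists_functional_charging h𝒜 hν hKconv hK0 hA hd hε hfar
    have hνu : 0 < ν univ := by
      obtain ⟨A, hA, hne⟩ := hlam0
      rw [← hνdef]
      exact (abs_pos.2 hne).trans_le ((FinAdd.abs_le_totalVar h𝒜 hlam hA).trans
        (FinAdd.content_mono h𝒜 (FinAdd.variation_nonneg h𝒜 hlam) hA h𝒜.univ_mem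
          (subset_univ A)))
    -- The total mass of the content, positive because φ charges Ω; dividing by it gives a
    -- probability.
    set r := φ (FinAdd.ind h𝒜 hν h𝒜.univ_mem) with hr
    have hr0 : 0 < r := (hpos _ _).lt_of_ne fun h0 => hνu.ne' (hnull _ h𝒜.univ_mem h0.symm)
    have hc' : 0 < r⁻¹ * (c + 1) := by positivity
    have hbd : ∀ f, |(r⁻¹ • φ) f| ≤ r⁻¹ * (c + 1) * FinAdd.L1Seminorm h𝒜 hν f := fun f => by
      rw [LinearMap.smul_apply, smul_eq_mul, abs_mul, abs_of_pos (inv_pos.2 hr0), mul_assoc]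
      exact mul_le_mul_of_nonneg_left ((hc f).trans
        (mul_le_mul_of_nonneg_right (by linarith) (apply_nonneg _ f))) (inv_pos.2 hr0).le
    have hm : ∀ A ∈ 𝒜, 0 ≤ FinAdd.contentOf h𝒜 hν (r⁻¹ • φ) A := fun A hA => by
      rw [FinAdd.contentOf_apply h𝒜 hν _ hA]
      exact mul_nonneg (inv_pos.2 hr0).le (hpos A hA)
    have hle := FinAdd.contentOf_le h𝒜 hν hbd
    refine ⟨FinAdd.contentOf h𝒜 hν (r⁻¹ • φ), ⟨hm, ?_⟩, ⟨fun k hk =>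
      FinAdd.L1_mono h𝒜 hν hm hc' hle (hKL1 hk), r⁻¹ * S, ?_⟩, ⟨_, hc', fun A hA => ?_⟩,
      fun A hA => ⟨fun h0 => ?_, fun h0 => ?_⟩⟩
    · rw [FinAdd.contentOf_apply h𝒜 hν _ h𝒜.univ_mem]
      exact inv_mul_cancel₀ hr0.ne'
    · rintro _ ⟨k, hk, rfl⟩
      rw [FinAdd.integral_contentOf h𝒜 hν hc' hbd hm ⟨k, hKL1 hk⟩]
      exact mul_le_mul_of_nonneg_left (hS ⟨k, hKL1 hk⟩ hk) (inv_pos.2 hr0).le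
    · rw [FinAdd.totalVar_of_nonneg h𝒜 hm hA]
      exact hle A hA
    · rw [FinAdd.contentOf_apply h𝒜 hν _ hA] at h0
      exact hnull A hA ((mul_eq_zero.1 h0).resolve_left (inv_pos.2 hr0).ne')
    · refine le_antisymm ?_ (hm A hA)
      simpa [h0] using hle A hA
  tfae_have 3 → 1 := by
    rintro ⟨m, ⟨hm, -⟩, ⟨hKm, S, hS⟩, ⟨c, hc, hmν⟩, hnull⟩ f hf hf0 hfpos
    have hmν' : ∀ A ∈ 𝒜, m A ≤ c * ν A := fun A hA =>
      (FinAdd.totalVar_of_nonneg h𝒜 hm hA).symm.trans_le (hmν A hA)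
    have hfm := FinAdd.L1_mono h𝒜 hν hm hc hmν' hf
    obtain ⟨δ, hδ, A, hA, hνA, hδA⟩ := FinAdd.exists_le_of_integral_pos h𝒜 hν hf hf0 hfpos
    have hmA : 0 < m A := (hm A hA).lt_of_ne fun h0 => hνA.ne' ((hnull A hA).1 h0.symm)
    have hIpos : 0 < FinAdd.integral 𝒜 m f := by
      have hsim := FinAdd.indicator_const_mem_sim h𝒜 hA δ
      have hle := FinAdd.integral_mono h𝒜 hm (FinAdd.L1_of_sim h𝒜 hm hsim) hfm fun ω => by
        by_cases hω : ω ∈ A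
        · simpa [hω] using hδA ω hω
        · simpa [hω] using hf0 ω
      rw [FinAdd.integral_of_sim h𝒜 hm hsim, FinAdd.simIntegral_indicator_const h𝒜 hA] at hle
      exact (mul_pos hδ hmA).trans_le hle
    -- This multiple of f has m-integral |S| + 1 > S.
    refine ⟨(|S| + 1) / FinAdd.integral 𝒜 m f, by positivity, fun hmem => ?_⟩
    have hle := FinAdd.integral_le_of_mem_closure h𝒜 hν hm hc hmν' hKm
      (fun k hk => hS ⟨k, hk, rfl⟩) hmem.1 hmem.2
    rw [FinAdd.integral_smul h𝒜 hm _ hfm, div_mul_cancel₀ _ hIpos.ne'] at hle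
    linarith [le_abs_self S]
  tfae_finish
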